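/- Let $\mathfrak c$ be the cardinality of the continuum, and let $\mathbb R^{\mathbb R}$, the real vector space of all functions $\mathbb R\to\mathbb R$, carry the topology $\tau_p$ of pointwise convergence. For a topological space $X$, a function $F\colon X\to\mathbb R$ is a \emph{connectivity} function if the graph of $F\restriction Z$ is connected for every connected $Z\subseteq X$. A function $f\colon\mathbb R\to\mathbb R$ is \emph{extendable} ($f\in\mathrm{Ext}$) if there is a connectivity function $F\colon\mathbb R\times[0,1]\to\mathbb R$ with $f(x)=F(x,0)$ for all $x\in\mathbb R$; it is \emph{strongly everywhere surjective} ($f\in\mathrm{SES}$) if $f^{-1}(y)\cap G$ has cardinality $\mathfrak c$ for every $y\in\mathbb R$ and every nonempty open $G\subseteq\mathbb R$. Let $\mathrm{Borel}$ be the class of Borel functions $\mathbb R\to\mathbb R$. For $M\subseteq\mathbb R^{\mathbb R}$ let $$\mathcal L_p(M)=\min\{\kappa\colon M\cup\{0\}\text{ contains no }\tau_p\text{-closed linear subspace of dimension}\ge\kappa\},$$ and call $M$ \emph{$\mu$-spaceable} if $M\cup\{0\}$ contains a $\tau_p$-closed linear subspace of dimension $\mu$ (dimension being the cardinality of a Hamel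 basis). Proposition. $\mathcal L_p\bigl((\mathrm{Ext}\cap\mathrm{SES})\setminus\mathrm{Borel}\bigr)=(2^{\mathfrak c})^+$. In particular, $(\mathrm{Ext}\cap\mathrm{SES})\setminus\mathrm{Borel}$ is $2^{\mathfrak c}$-spaceable with respect to $\tau_p$; that is, $2^{\mathfrak c}$ is the maximal dimension of a $\tau_p$-closed linear subspace of $\bigl((\mathrm{Ext}\cap\mathrm{SES})\setminus\mathrm{Borel}\bigr)\cup\{0\}$. -/

import Mathlib

open Cardinal

/-- `f` is a connectivity function: the graph of `f` restricted to `Z` is connected for every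
connected `Z ⊆ X`. -/
def IsConnectivity {X : Type*} [TopologicalSpace X] (f : X → ℝ) : Prop :=
  ∀ Z : Set X, IsConnected Z → IsConnected {p : X × ℝ | p.1 ∈ Z ∧ p.2 = f p.1}

/-- `f` is extendable: it is the restriction to `X × {0}` of a connectivity function on
`X × [0,1]`. -/
def IsExtendable {X : Type*} [TopologicalSpace X] (f : X → ℝ) : Prop :=
  ∃ F : X × unitInterval → ℝ, IsConnectivity F ∧ ∀ x, f x = F (x, 0)

/-- `f` is strongly everywhere surjective: `f⁻¹(y) ∩ G` has cardinality continuum for every real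
`y` and every nonempty open set `G`. -/
def IsStronglyEverywhereSurjective {X : Type*} [TopologicalSpace X] (f : X → ℝ) : Prop :=
  ∀ (y : ℝ) (G : Set X), IsOpen G → G.Nonempty → #(f ⁻¹' {y} ∩ G : Set X) = 𝔠

/-- The class of extendable functions on the line. -/
def ExtFun : Set (ℝ → ℝ) := {f | IsExtendable f}

/-- The class of strongly everywhere surjective functions on the line. -/
def SESFun : Set (ℝ → ℝ) := {f | IsStronglyEverywhereSurjective f}

/-- The class of Borel functions on the line (`ℝ` carries its Borel σ-algebra). -/
def BorelFun : Set (ℝ → ℝ) := {f | Measurable f}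

/-- `M` is `μ`-spaceable for the topology of `W`: some closed linear subspace `V ⊆ M ∪ {0}` has
dimension `μ`. -/
def IsSpaceable (K : Type*) {W : Type*} [Field K] [AddCommGroup W] [Module K W]
    [TopologicalSpace W] (M : Set W) (μ : Cardinal) : Prop :=
  ∃ V : Submodule K W, IsClosed (V : Set W) ∧ (V : Set W) ⊆ M ∪ {0} ∧ Module.rank K V = μ

/-- The spaceability number of `M` for the topology of `W`: the least cardinal `κ` such that
`M ∪ {0}` contains no closed linear subspace of dimension at least `κ`. (Closed subspaces of all
smaller dimensions need not exist: in `ℝ → ℝ` with the pointwise topology, no closed subspace has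
dimension `ℵ₀`.) -/
noncomputable def spaceabilityNumber (K : Type*) {W : Type*} [Field K] [AddCommGroup W]
    [Module K W] [TopologicalSpace W] (M : Set W) : Cardinal :=
  sInf {κ | ¬ ∃ μ, κ ≤ μ ∧ IsSpaceable K M μ}

/-!
For suitable `σ, φ : ℝ → ℝ`, the subspace consists of the functions `x ↦ g (σ x) * φ x`, where `g`
is an arbitrary function. It is isomorphic to `ℝ → ℝ`, hence of dimension `2 ^ 𝔠`, the largest one
possible, and it is closed, being defined by linear equations between values at two points. What
has to be arranged is that `g s ≠ 0`, for a single `s`, forces the product to be extendable,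
strongly everywhere surjective and not Borel, no matter what `g` does elsewhere. So each `s` needs
its own set `A` of reals, disjoint from the others, such that suitable values on `A` make a
function extendable whatever its values on the other sets.

**Connectivity.** If every point `p` of a space has small open connected neighbourhoods whose
frontier lies in a connected set on which `F` is close to `F p`, then `F` is a connectivity
function (`isConnectivity_of_cells`). A separation of the graph over a connected `Z` gives two
kinds of neighbourhoods, whose frontier sets are disjoint when the kinds differ. Two points of
different kinds are joined by a finite chain of such neighbourhoods, of tiny size and pairwise
non-nested. Two intersecting ones have intersecting frontier sets, so all are of one kind, and the
chain cannot leave a fixed neighbourhood of the other kind.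

**Extendability.** Let `r n` be continuous functions on the line, placed as rows at the heights
`1 / (n + 1)` of the strip `ℝ × [0, 1]` and interpolated in between, such that `r n` is nearly
constant at a scale `δ n` at which the points with `r (n + 1) = r n` are dense (`IsRowSystem`).
Following such points from row to row, one can descend from any point of row `n` to the line, on
either side, almost without changing the value. Two descending curves and a piece of the row bound
a neighbourhood of `(x, 0)`, so `f` is extendable if `f x` is a cluster point of `r n x` for every
`x` (`IsRowSystem.isExtendable`).

**The rows.** For a phase `s`, let `K n` be the arithmetic progression of step `scale n` shifted by
`s * scale n`, and let the stage `n` fix the row on `K n`, shrink it near `K n`, and replace it by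
`a n` far from `K n`, where `a n` is `0` at even stages and returns near every real infinitely
often at odd ones. On the set `tailSet s` of the points that are eventually near `K n` the rows
converge, while off this set they vanish infinitely often. Different phases have disjoint tail
sets, and on `tailSet t` with `t ≠ s` the rows with phase `s` eventually take the values `a n`, so
that every real is a cluster point there. Hence only the values on `tailSet s` matter, provided `f`
vanishes off all tail sets (`exists_limits_isExtendable`). As every tail set is dense, surplus tail
sets supply the points needed for strong surjectivity and, by a cardinality argument, for not being
Borel (`exists_label_and_weight`).
-/

/-! ### A sufficient condition for connectivity -/

/-- A cell of size `δ`: a nonempty open connected set `m.1` whose frontier lies in a connected set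
`m.2`, both sets being contained in a common ball of radius `δ`. -/
structure IsCell {X : Type*} [MetricSpace X] (δ : ℝ) (m : Set X × Set X) : Prop where
  isOpen : IsOpen m.1
  nonempty : m.1.Nonempty
  preconn : IsPreconnected m.1
  preconn_snd : IsPreconnected m.2
  frontier_subset : frontier m.1 ⊆ m.2
  exists_ball : ∃ z, m.1 ⊆ Metric.ball z δ ∧ m.2 ⊆ Metric.ball z δ

theorem IsCell.mono {X : Type*} [MetricSpace X] {δ δ' : ℝ} {m : Set X × Set X} (hm : IsCell δ m)
    (h : δ ≤ δ') : IsCell δ' m := by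
  obtain ⟨z, h1, h2⟩ := hm.exists_ball
  exact { hm with
    exists_ball := ⟨z, h1.trans (Metric.ball_subset_ball h), h2.trans (Metric.ball_subset_ball h)⟩ }

theorem IsPreconnected.subset_of_disjoint_frontier {X : Type*} [TopologicalSpace X] {s t : Set X}
    (ht : IsPreconnected t) (hs : IsOpen s) (hne : (t ∩ s).Nonempty)
    (hd : Disjoint t (frontier s)) : t ⊆ s := by
  refine ht.subset_of_closure_inter_subset hs hne fun x hx => ?_
  by_contra hxs
  exact Set.disjoint_left.1 hd hx.2 ⟨hx.1, by rwa [hs.interior_eq]⟩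

/-- If every point of a connected set `Z` lies in the open connected first component of a pair with
the property `Q`, then any two points of `Z` are joined by pairs with that property whose first
components are pairwise non-nested and have connected union: a finite chain exists by connectedness,
and discarding its non-maximal members does not change the union. -/
theorem exists_nonnested_cells {X : Type*} [TopologicalSpace X] {Z : Set X}
    (hZ : IsPreconnected Z) (Q : Set X × Set X → Prop)
    (hQ : ∀ z ∈ Z, ∃ m, Q m ∧ IsOpen m.1 ∧ IsPreconnected m.1 ∧ z ∈ m.1) {a b : X} (ha : a ∈ Z)
    (hb : b ∈ Z) :
    ∃ M : Set (Set X × Set X), (∀ m ∈ M, Q m) ∧ IsPreconnected (⋃ m ∈ M, m.1) ∧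
      (∀ m ∈ M, ∀ m' ∈ M, ¬ m.1 ⊂ m'.1) ∧ (∃ m ∈ M, a ∈ m.1) ∧ ∃ m ∈ M, b ∈ m.1 := by
  let P : X → X → Prop := fun x y => ∃ M : Set (Set X × Set X), M.Finite ∧ (∀ m ∈ M, Q m) ∧
    IsPreconnected (⋃ m ∈ M, m.1) ∧ (∃ m ∈ M, x ∈ m.1) ∧ ∃ m ∈ M, y ∈ m.1
  have hP : P a b := by
    refine hZ.induction₂ P ?_ ?_ ?_ ha hb
    · intro z hz
      obtain ⟨m, hm, ho, hc, hzm⟩ := hQ z hz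
      filter_upwards [mem_nhdsWithin_of_mem_nhds (ho.mem_nhds hzm)] with y hy
      exact ⟨{m}, Set.finite_singleton m, by simpa using hm, by simpa using hc,
        ⟨m, rfl, hzm⟩, ⟨m, rfl, hy⟩⟩
    · rintro x y z _ hy _ ⟨M, hMf, hMQ, hMc, hx, m, hm, hym⟩
        ⟨M', hMf', hMQ', hMc', ⟨m', hm', hym'⟩, hz⟩
      refine ⟨M ∪ M', hMf.union hMf', ?_, ?_, ?_, ?_⟩
      · rintro m (h | h)
        exacts [hMQ m h, hMQ' m h]
      · rw [Set.biUnion_union]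
        exact hMc.union y (Set.mem_iUnion₂.2 ⟨m, hm, hym⟩)
          (Set.mem_iUnion₂.2 ⟨m', hm', hym'⟩) hMc'
      · obtain ⟨n, hn, hxn⟩ := hx
        exact ⟨n, Or.inl hn, hxn⟩
      · obtain ⟨n, hn, hxn⟩ := hz
        exact ⟨n, Or.inr hn, hxn⟩
    · rintro x y _ _ ⟨M, hMf, hMQ, hMc, hx, hy⟩
      exact ⟨M, hMf, hMQ, hMc, hy, hx⟩
  obtain ⟨M, hMf, hMQ, hMc, ⟨m, hm, ham⟩, ⟨m', hm', hbm'⟩⟩ := hP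
  have hup : ∀ n ∈ M, ∃ k ∈ M, Maximal (· ∈ Prod.fst '' M) k.1 ∧ n.1 ⊆ k.1 := by
    intro n hn
    obtain ⟨w, hw, hmax⟩ := (hMf.image Prod.fst).exists_le_maximal (Set.mem_image_of_mem _ hn)
    obtain ⟨k, hk, rfl⟩ := hmax.prop
    exact ⟨k, hk, hmax, hw⟩
  refine ⟨{k ∈ M | Maximal (· ∈ Prod.fst '' M) k.1}, fun k hk => hMQ k hk.1, ?_, ?_, ?_, ?_⟩
  · convert hMc using 1
    refine subset_antisymm (Set.biUnion_subset_biUnion_left fun k hk => hk.1) ?_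
    refine Set.iUnion₂_subset fun n hn => ?_
    obtain ⟨k, hk, hkm, hnk⟩ := hup n hn
    exact hnk.trans (Set.subset_biUnion_of_mem (u := fun k : Set X × Set X => k.1) ⟨hk, hkm⟩)
  · intro k hk k' hk' hlt
    exact hlt.2 (hk.2.2 (Set.mem_image_of_mem _ hk'.1) hlt.1)
  · obtain ⟨k, hk, hkm, hnk⟩ := hup m hm
    exact ⟨k, ⟨hk, hkm⟩, hnk ham⟩
  · obtain ⟨k, hk, hkm, hnk⟩ := hup m' hm'
    exact ⟨k, ⟨hk, hkm⟩, hnk hbm'⟩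

section Cells

variable {X : Type*} [MetricSpace X] [PreconnectedSpace X]

theorem IsCell.frontier_nonempty (hX : ∀ p q : X, Metric.ball p 1 ∪ Metric.ball q 1 ≠ Set.univ)
    {m : Set X × Set X} (hm : IsCell 1 m) : (frontier m.1).Nonempty := by
  rw [nonempty_frontier_iff]
  refine ⟨hm.nonempty, fun h => ?_⟩
  obtain ⟨z, hz, -⟩ := hm.exists_ball
  refine hX z z (Set.eq_univ_of_univ_subset ?_)
  rw [← h, Set.union_self]
  exact hz

/-- Two intersecting cells whose frontier continua are disjoint are strictly nested: otherwise
their union would be closed and open. -/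
theorem IsCell.ssubset_or_ssubset
    (hX : ∀ p q : X, Metric.ball p 1 ∪ Metric.ball q 1 ≠ Set.univ)
    {m m' : Set X × Set X} (hm : IsCell 1 m) (hm' : IsCell 1 m')
    (hne : (m.1 ∩ m'.1).Nonempty) (hd : Disjoint m.2 m'.2) : m.1 ⊂ m'.1 ∨ m'.1 ⊂ m.1 := by
  have hne_eq : m.1 ≠ m'.1 := by
    intro h
    obtain ⟨x, hx⟩ := hm.frontier_nonempty hX
    exact Set.disjoint_left.1 hd (hm.frontier_subset hx) (hm'.frontier_subset (h ▸ hx))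
  by_contra! hcon
  have h1 : ¬ m.1 ⊆ m'.1 := fun h => hcon.1 (h.ssubset_of_ne hne_eq)
  have h2 : ¬ m'.1 ⊆ m.1 := fun h => hcon.2 (h.ssubset_of_ne hne_eq.symm)
  have key : ∀ {a b : Set X × Set X}, IsCell 1 a → IsCell 1 b → (a.1 ∩ b.1).Nonempty →
      Disjoint a.2 b.2 → ¬ a.1 ⊆ b.1 → frontier b.1 ⊆ a.1 := by
    intro a b ha hb hab hdab hsub
    obtain ⟨y, hy, hy'⟩ : (a.1 ∩ frontier b.1).Nonempty := by
      by_contra h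
      exact hsub (ha.preconn.subset_of_disjoint_frontier hb.isOpen hab
        (Set.disjoint_iff_inter_eq_empty.2 (Set.not_nonempty_iff_eq_empty.1 h)))
    exact hb.frontier_subset.trans (hb.preconn_snd.subset_of_disjoint_frontier ha.isOpen
      ⟨y, hb.frontier_subset hy', hy⟩ (hdab.symm.mono_right ha.frontier_subset))
  have k1 := key hm hm' hne hd h1
  have k2 := key hm' hm (Set.inter_comm _ _ ▸ hne) hd.symm h2
  have hclosed : IsClosed (m.1 ∪ m'.1) := by
    refine isClosed_of_closure_subset ?_
    rw [closure_union, closure_eq_self_union_frontier, closure_eq_self_union_frontier]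
    rintro x ((h | h) | (h | h))
    exacts [Or.inl h, Or.inr (k2 h), Or.inr h, Or.inl (k1 h)]
  have huniv : m.1 ∪ m'.1 = Set.univ :=
    IsClopen.eq_univ ⟨hclosed, hm.isOpen.union hm'.isOpen⟩
      (hm.nonempty.mono Set.subset_union_left)
  obtain ⟨z, hz, -⟩ := hm.exists_ball
  obtain ⟨z', hz', -⟩ := hm'.exists_ball
  exact hX z z' (Set.eq_univ_of_univ_subset (huniv ▸ Set.union_subset_union hz hz'))

/-- In a family of pairwise non-nested cells with connected union, no property of cells can split
the frontier continua into two disjoint groups. -/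
theorem IsCell.forall_of_preconnected
    (hX : ∀ p q : X, Metric.ball p 1 ∪ Metric.ball q 1 ≠ Set.univ)
    {M : Set (Set X × Set X)} (hM : ∀ m ∈ M, IsCell 1 m)
    (hconn : IsPreconnected (⋃ m ∈ M, m.1)) (hmax : ∀ m ∈ M, ∀ m' ∈ M, ¬ m.1 ⊂ m'.1)
    (A : Set X × Set X → Prop) (hA : ∀ m ∈ M, ∀ m' ∈ M, A m → ¬ A m' → Disjoint m.2 m'.2)
    {m m' : Set X × Set X} (hm : m ∈ M) (hm' : m' ∈ M) (hAm : A m) : A m' := by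
  by_contra hAm'
  obtain ⟨x, hx⟩ := (hM m hm).nonempty
  obtain ⟨x', hx'⟩ := (hM m' hm').nonempty
  obtain ⟨y, -, hy1, hy2⟩ := hconn (⋃ n ∈ {n ∈ M | A n}, n.1) (⋃ n ∈ {n ∈ M | ¬ A n}, n.1)
    (isOpen_biUnion fun n hn => (hM n hn.1).isOpen) (isOpen_biUnion fun n hn => (hM n hn.1).isOpen)
    (by
      intro z hz
      obtain ⟨n, hn, hz⟩ := Set.mem_iUnion₂.1 hz
      by_cases h : A n
      · exact Or.inl (Set.mem_iUnion₂.2 ⟨n, ⟨hn, h⟩, hz⟩)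
      · exact Or.inr (Set.mem_iUnion₂.2 ⟨n, ⟨hn, h⟩, hz⟩))
    ⟨x, Set.mem_iUnion₂.2 ⟨m, hm, hx⟩, Set.mem_iUnion₂.2 ⟨m, ⟨hm, hAm⟩, hx⟩⟩
    ⟨x', Set.mem_iUnion₂.2 ⟨m', hm', hx'⟩, Set.mem_iUnion₂.2 ⟨m', ⟨hm', hAm'⟩, hx'⟩⟩
  obtain ⟨n, hn, hyn⟩ := Set.mem_iUnion₂.1 hy1
  obtain ⟨n', hn', hyn'⟩ := Set.mem_iUnion₂.1 hy2
  rcases (hM n hn.1).ssubset_or_ssubset hX (hM n' hn'.1) ⟨y, hyn, hyn'⟩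
    (hA n hn.1 n' hn'.1 hn.2 hn'.2) with h | h
  · exact hmax n hn.1 n' hn'.1 h
  · exact hmax n' hn'.1 n hn.1 h

/-- Non-nested small cells of connected union whose frontier continua miss that of a fixed cell `c`
around `a` cannot lead from `a` to a point `b` outside the closure of `c`. -/
theorem IsCell.false_of_chain
    (hX : ∀ p q : X, Metric.ball p 1 ∪ Metric.ball q 1 ≠ Set.univ)
    {c : Set X × Set X} (hc : IsCell 1 c) {δ : ℝ} (hδ : δ ≤ 1) {a b : X}
    (ha : Metric.ball a (2 * δ) ⊆ c.1) (hb : Disjoint (Metric.ball b (2 * δ)) c.1)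
    {M : Set (Set X × Set X)} (hM : ∀ m ∈ M, IsCell δ m) (hdis : ∀ m ∈ M, Disjoint m.2 c.2)
    (hconn : IsPreconnected (⋃ m ∈ M, m.1)) (hmax : ∀ m ∈ M, ∀ m' ∈ M, ¬ m.1 ⊂ m'.1)
    (haM : ∃ m ∈ M, a ∈ m.1) (hbM : ∃ m ∈ M, b ∈ m.1) : False := by
  have hM1 : ∀ m ∈ M, IsCell 1 m := fun m hm => (hM m hm).mono hδ
  have hsmall : ∀ m ∈ M, ∀ x ∈ m.1, m.2 ⊆ Metric.ball x (2 * δ) := by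
    intro m hm x hx y hy
    obtain ⟨z, h1, h2⟩ := (hM m hm).exists_ball
    have e1 := Metric.mem_ball.1 (h1 hx)
    have e2 := Metric.mem_ball.1 (h2 hy)
    rw [Metric.mem_ball]
    linarith [dist_triangle_right y x z]
  have hne : ∀ m ∈ M, m.2.Nonempty := fun m hm =>
    ((hM1 m hm).frontier_nonempty hX).mono (hM1 m hm).frontier_subset
  obtain ⟨m, hm, ham⟩ := haM
  obtain ⟨m', hm', hbm'⟩ := hbM
  have hAm : (m.2 ∩ c.1).Nonempty := by
    obtain ⟨y, hy⟩ := hne m hm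
    exact ⟨y, hy, ha (hsmall m hm a ham hy)⟩
  have hAm' := IsCell.forall_of_preconnected hX hM1 hconn hmax (fun n => (n.2 ∩ c.1).Nonempty)
    (by
      intro n hn n' hn' hA hA'
      have hsub : n.2 ⊆ c.1 := (hM n hn).preconn_snd.subset_of_disjoint_frontier hc.isOpen hA
        ((hdis n hn).mono_right hc.frontier_subset)
      rw [Set.disjoint_left]
      exact fun y hy hy' => hA' ⟨y, hy', hsub hy⟩)
    hm hm' hAm
  obtain ⟨y, hy, hyc⟩ := hAm'
  exact Set.disjoint_left.1 hb (hsmall m' hm' b hbm' hy) hyc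

/-- Peripheral continuity with connected frontiers implies connectivity, on a connected space that
is not the union of two balls of radius one. -/
theorem isConnectivity_of_cells
    (hX : ∀ p q : X, Metric.ball p 1 ∪ Metric.ball q 1 ≠ Set.univ) {F : X → ℝ}
    (hF : ∀ p : X, ∀ ε > 0, ∃ W C : Set X, IsOpen W ∧ p ∈ W ∧ IsPreconnected W ∧
      W ⊆ Metric.ball p ε ∧ IsPreconnected C ∧ frontier W ⊆ C ∧ C ⊆ Metric.ball p ε ∧
      ∀ c ∈ C, |F c - F p| < ε) : IsConnectivity F := by
  intro Z hZ
  set Γ : Set (X × ℝ) := {p | p.1 ∈ Z ∧ p.2 = F p.1} with hΓ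
  refine ⟨hZ.nonempty.imp' (fun z => (z, F z)) fun z hz => ⟨hz, rfl⟩, ?_⟩
  rw [isPreconnected_iff_subset_of_disjoint]
  intro u v hu hv huv hdis
  by_contra! hcon
  obtain ⟨hnu, hnv⟩ := hcon
  obtain ⟨b', hb'Γ, hb'u⟩ := Set.not_subset.1 hnu
  obtain ⟨a', ha'Γ, ha'v⟩ := Set.not_subset.1 hnv
  have hb'v : b' ∈ v := (huv hb'Γ).resolve_left hb'u
  have ha'u : a' ∈ u := (huv ha'Γ).resolve_right ha'v
  -- `Γ ∩ u` and `Γ ∩ v` are separated sets, hence have disjoint open neighbourhoods.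
  obtain ⟨O₁, O₂, hO₁, hO₂, h₁, h₂, hO⟩ : SeparatedNhds (Γ ∩ u) (Γ ∩ v) := by
    have aux : ∀ {u v : Set (X × ℝ)}, IsOpen v → Γ ∩ (u ∩ v) = ∅ →
        Disjoint (closure (Γ ∩ u)) (Γ ∩ v) := fun {u v} hv h => by
      refine Disjoint.mono_right Set.inter_subset_right (Disjoint.closure_left ?_ hv)
      rw [Set.disjoint_iff_inter_eq_empty, Set.inter_assoc, h]
    rw [separatedNhds_iff_disjoint]
    exact completely_normal (aux hv hdis) (aux hu (by rwa [Set.inter_comm v u])).symm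
  have hOdis : ∀ x, (x, F x) ∈ O₁ → (x, F x) ∈ O₂ → False := fun x h h' =>
    Set.disjoint_left.1 hO h h'
  -- small cells around each point of `Z`, with the graph of `F` over the frontier controlled
  have hcell : ∀ z : X, ∀ O : Set (X × ℝ), IsOpen O → (z, F z) ∈ O → ∀ δ > 0,
      ∃ m, IsCell δ m ∧ z ∈ m.1 ∧ m.1 ⊆ Metric.ball z δ ∧ ∀ c ∈ m.2, (c, F c) ∈ O := by
    intro z O hO hz δ hδ
    obtain ⟨η, hη, hηO⟩ := Metric.isOpen_iff.1 hO _ hz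
    obtain ⟨W, C, h1, h2, h3, h4, h5, h6, h7, h8⟩ := hF z (min δ η) (lt_min hδ hη)
    have hb := Metric.ball_subset_ball (x := z) (min_le_left δ η)
    refine ⟨(W, C), ⟨h1, ⟨z, h2⟩, h3, h5, h6, z, h4.trans hb, h7.trans hb⟩, h2, h4.trans hb, ?_⟩
    intro c hc
    refine hηO ?_
    rw [← ball_prod_same]
    exact ⟨Metric.ball_subset_ball (min_le_right δ η) (h7 hc),
      (Real.dist_eq _ _).trans_lt ((h8 c hc).trans_le (min_le_right δ η))⟩
  obtain ⟨a, ha, haO⟩ : ∃ a ∈ Z, (a, F a) ∈ O₁ := by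
    have : a' = (a'.1, F a'.1) := Prod.ext rfl ha'Γ.2
    exact ⟨a'.1, ha'Γ.1, this ▸ h₁ ⟨ha'Γ, ha'u⟩⟩
  obtain ⟨b, hb, hbO⟩ : ∃ b ∈ Z, (b, F b) ∈ O₂ := by
    have : b' = (b'.1, F b'.1) := Prod.ext rfl hb'Γ.2
    exact ⟨b'.1, hb'Γ.1, this ▸ h₂ ⟨hb'Γ, hb'v⟩⟩
  have hab : a ≠ b := by
    rintro rfl
    exact hOdis _ haO hbO
  have hd : 0 < dist a b := dist_pos.2 hab
  have hr : 0 < min 1 (dist a b / 2) := lt_min one_pos (half_pos hd)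
  have hball : Disjoint (Metric.ball a (min 1 (dist a b / 2))) (Metric.ball b (dist a b / 2)) :=
    (Metric.ball_disjoint_ball (by linarith)).mono_left
      (Metric.ball_subset_ball (min_le_right _ _))
  have hball' : Disjoint (Metric.ball b (min 1 (dist a b / 2))) (Metric.ball a (dist a b / 2)) :=
    (Metric.ball_disjoint_ball (by rw [dist_comm]; linarith)).mono_left
      (Metric.ball_subset_ball (min_le_right _ _))
  obtain ⟨ca, hca, haca, hcab, hcaO⟩ := hcell a O₁ hO₁ haO _ hr
  obtain ⟨cb, hcb, hbcb, hcbb, hcbO⟩ := hcell b O₂ hO₂ hbO _ hr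
  obtain ⟨ηa, hηa, hηa'⟩ := Metric.isOpen_iff.1 hca.isOpen a haca
  obtain ⟨ηb, hηb, hηb'⟩ := Metric.isOpen_iff.1 hcb.isOpen b hbcb
  obtain ⟨δ, hδ, hδ1, hδa, hδb, hδd⟩ : ∃ δ > 0, δ ≤ 1 ∧ 2 * δ ≤ ηa ∧ 2 * δ ≤ ηb ∧
      2 * δ ≤ dist a b / 2 := by
    refine ⟨min 1 (min (ηa / 2) (min (ηb / 2) (dist a b / 4))), by positivity, min_le_left _ _,
      ?_, ?_, ?_⟩
    · linarith [(min_le_right 1 (min (ηa / 2) (min (ηb / 2) (dist a b / 4)))).trans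
        (min_le_left _ _)]
    · linarith [(min_le_right 1 (min (ηa / 2) (min (ηb / 2) (dist a b / 4)))).trans
        ((min_le_right _ _).trans (min_le_left _ _))]
    · linarith [(min_le_right 1 (min (ηa / 2) (min (ηb / 2) (dist a b / 4)))).trans
        ((min_le_right _ _).trans (min_le_right _ _))]
  obtain ⟨M, hM, hMc, hMmax, haM, hbM⟩ := exists_nonnested_cells hZ.isPreconnected
    (fun m => IsCell δ m ∧ ((∀ c ∈ m.2, (c, F c) ∈ O₁) ∨ ∀ c ∈ m.2, (c, F c) ∈ O₂))
    (by
      intro z hz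
      rcases huv (show (z, F z) ∈ Γ from ⟨hz, rfl⟩) with h | h
      · obtain ⟨m, hm, hzm, -, hmO⟩ := hcell z O₁ hO₁ (h₁ ⟨⟨hz, rfl⟩, h⟩) δ hδ
        exact ⟨m, ⟨hm, Or.inl hmO⟩, hm.isOpen, hm.preconn, hzm⟩
      · obtain ⟨m, hm, hzm, -, hmO⟩ := hcell z O₂ hO₂ (h₂ ⟨⟨hz, rfl⟩, h⟩) δ hδ
        exact ⟨m, ⟨hm, Or.inr hmO⟩, hm.isOpen, hm.preconn, hzm⟩) ha hb
  have hMδ : ∀ m ∈ M, IsCell δ m := fun m hm => (hM m hm).1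
  have hMne : ∀ m ∈ M, m.2.Nonempty := fun m hm =>
    (((hMδ m hm).mono hδ1).frontier_nonempty hX).mono (hMδ m hm).frontier_subset
  have hall := fun {m m'} (hm : m ∈ M) (hm' : m' ∈ M) =>
    IsCell.forall_of_preconnected hX (fun m hm => (hMδ m hm).mono hδ1) hMc hMmax
      (fun m => ∀ c ∈ m.2, (c, F c) ∈ O₁)
      (fun n hn n' hn' h h' => Set.disjoint_left.2 fun x hx hx' =>
        hOdis x (h x hx) (((hM n' hn').2.resolve_left h') x hx')) hm hm'
  obtain ⟨m₀, hm₀, ham₀⟩ := haM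
  -- All cells of the chain are of the same kind; the cell around `a` or around `b` is of the
  -- other kind and cannot be left by the chain.
  by_cases h0 : ∀ c ∈ m₀.2, (c, F c) ∈ O₁
  · refine IsCell.false_of_chain hX (hcb.mono (min_le_left _ _)) hδ1
      ((Metric.ball_subset_ball hδb).trans hηb')
      (hball'.symm.mono (Metric.ball_subset_ball hδd) hcbb) hMδ ?_ hMc hMmax hbM ⟨m₀, hm₀, ham₀⟩
    exact fun m hm => Set.disjoint_left.2 fun x hx hx' =>
      hOdis x (hall hm₀ hm h0 x hx) (hcbO x hx')
  · refine IsCell.false_of_chain hX (hca.mono (min_le_left _ _)) hδ1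
      ((Metric.ball_subset_ball hδa).trans hηa')
      (hball.symm.mono (Metric.ball_subset_ball hδd) hcab) hMδ ?_ hMc hMmax ⟨m₀, hm₀, ham₀⟩ hbM
    refine fun m hm => Set.disjoint_left.2 fun x hx hx' => ?_
    have h1 : ¬ ∀ c ∈ m.2, (c, F c) ∈ O₁ := fun h => h0 (hall hm hm₀ h)
    exact hOdis x (hcaO x hx') (((hM m hm).2.resolve_left h1) x hx)

end Cells

/-! ### Piecewise linear interpolation of sequences -/

/-- The piecewise linear function of `τ ≥ 0` with value `a n` at `τ = n`. -/
noncomputable def seqInterp (a : ℕ → ℝ) (τ : ℝ) : ℝ :=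
  a 0 + ∑ k ∈ Finset.range (⌊τ⌋₊ + 1), (a (k + 1) - a k) * max 0 (min 1 (τ - k))

theorem seqInterp_eq_sum (a : ℕ → ℝ) {τ : ℝ} {N : ℕ} (hN0 : N ≠ 0) (h : τ < N) :
    seqInterp a τ = a 0 + ∑ k ∈ Finset.range N, (a (k + 1) - a k) * max 0 (min 1 (τ - k)) := by
  rw [seqInterp]
  congr 1
  have hN : ⌊τ⌋₊ + 1 ≤ N := (Nat.floor_lt' hN0).2 h
  refine Finset.sum_subset (Finset.range_mono hN) fun k _ hk => ?_
  have hk' : τ < k := by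
    have : ⌊τ⌋₊ < k := by simpa using hk
    exact Nat.lt_of_floor_lt this
  rw [max_eq_left ((min_le_right _ _).trans (by linarith)), mul_zero]

theorem seqInterp_of_mem (a : ℕ → ℝ) {τ : ℝ} {k : ℕ} (h : k ≤ τ) (h' : τ ≤ k + 1) :
    seqInterp a τ = a k + (τ - k) * (a (k + 1) - a k) := by
  have hN : τ < (k + 2 : ℕ) := by push_cast; linarith
  rw [seqInterp_eq_sum a (by lia) hN, Finset.sum_range_succ, Finset.sum_range_succ]
  have h1 : max 0 (min 1 (τ - (k + 1 : ℕ))) = 0 :=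
    max_eq_left ((min_le_right _ _).trans (by push_cast; linarith))
  have h2 : max 0 (min 1 (τ - k)) = τ - k := by
    rw [min_eq_right (by linarith), max_eq_right (by linarith)]
  have h3 : ∀ j ∈ Finset.range k, (a (j + 1) - a j) * max 0 (min 1 (τ - j)) = a (j + 1) - a j := by
    intro j hj
    have : (j : ℝ) + 1 ≤ k := by exact_mod_cast Finset.mem_range.1 hj
    rw [min_eq_left (by linarith), max_eq_right zero_le_one, mul_one]
  rw [h1, h2, Finset.sum_congr rfl h3, Finset.sum_range_sub]
  ring

theorem seqInterp_mem_Icc {a : ℕ → ℝ} {τ A B : ℝ} {k : ℕ} (h : k ≤ τ) (h' : τ ≤ k + 1)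
    (h1 : a k ∈ Set.Icc A B) (h2 : a (k + 1) ∈ Set.Icc A B) : seqInterp a τ ∈ Set.Icc A B := by
  rw [seqInterp_of_mem a h h']
  have := (convex_Icc A B) h1 h2 (a := 1 - (τ - k)) (b := τ - k) (by linarith) (by linarith)
    (by ring)
  convert this using 1
  simp only [smul_eq_mul]
  ring

/-- The function on the strip that equals `f` at height `0`, equals the row `r n` at height
`1 / (n + 1)`, and interpolates between successive rows. The interpolation is linear in the time
`1 / y - 1`, not in the height `y`, so that the row `n` is met at the time `n`. -/
noncomputable def stripExt (r : ℕ → ℝ → ℝ) (f : ℝ → ℝ) (p : ℝ × unitInterval) : ℝ :=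
  if p.2 = 0 then f p.1 else seqInterp (fun n => r n p.1) (1 / (p.2 : ℝ) - 1)

/-- A positive height lies between two consecutive rows `k` and `k + 1`, and `n ≤ k` when it is at
most the height of the row `n`. -/
theorem unitInterval.exists_floor {y : unitInterval} (hy : y ≠ 0) :
    ∃ k : ℕ, (k : ℝ) ≤ 1 / (y : ℝ) - 1 ∧ 1 / (y : ℝ) - 1 ≤ k + 1 ∧
      (∀ n : ℕ, (y : ℝ) ≤ 1 / (n + 1) → n ≤ k) := by
  have hy0 : (0 : ℝ) < y := unitInterval.pos_iff_ne_zero.2 hy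
  have h0 : (0 : ℝ) ≤ 1 / (y : ℝ) - 1 := by
    rw [sub_nonneg, le_div_iff₀ hy0, one_mul]
    exact y.2.2
  refine ⟨⌊1 / (y : ℝ) - 1⌋₊, Nat.floor_le h0, (Nat.lt_floor_add_one _).le, fun n hn => ?_⟩
  refine Nat.le_floor ?_
  rw [le_sub_iff_add_le, le_div_comm₀ (by positivity) hy0]
  exact hn

theorem continuousAt_stripExt {r : ℕ → ℝ → ℝ} (hr : ∀ n, Continuous (r n)) (f : ℝ → ℝ)
    {p : ℝ × unitInterval} (hp : p.2 ≠ 0) : ContinuousAt (stripExt r f) p := by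
  obtain ⟨N, hN⟩ := exists_nat_gt (max 0 (1 / (p.2 : ℝ) - 1))
  have hN0 : N ≠ 0 := by
    rintro rfl
    exact absurd hN (not_lt.2 (by simp))
  replace hN := (le_max_right _ _).trans_lt hN
  have hp' : (p.2 : ℝ) ≠ 0 := fun h => hp (Subtype.ext h)
  have hc : ContinuousAt (fun q : ℝ × unitInterval => 1 / (q.2 : ℝ) - 1) p :=
    ContinuousAt.sub (ContinuousAt.div (by fun_prop) (by fun_prop) hp') continuousAt_const
  have hev : stripExt r f =ᶠ[nhds p] fun q => r 0 q.1 + ∑ k ∈ Finset.range N,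
      (r (k + 1) q.1 - r k q.1) * max 0 (min 1 ((1 / (q.2 : ℝ) - 1) - k)) := by
    filter_upwards [hc.eventually_lt_const hN,
      continuousAt_snd.eventually_ne hp] with q hq hq'
    rw [stripExt, if_neg hq', seqInterp_eq_sum _ hN0 hq]
  refine ContinuousAt.congr ?_ hev.symm
  refine ContinuousAt.add (by fun_prop) (tendsto_finsetSum _ fun k _ => ?_)
  exact ContinuousAt.mul (by fun_prop)
    (continuousAt_const.max (continuousAt_const.min (hc.sub continuousAt_const)))

/-! ### Row systems and extendability -/

/-- Continuous functions `r n` on the line such that, at the scale `δ n`, `r n` is nearly constant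
and there are points, on both sides of every point, where `r (n + 1)` agrees with `r n`. -/
structure IsRowSystem (r : ℕ → ℝ → ℝ) (δ : ℕ → ℝ) : Prop where
  continuous : ∀ n, Continuous (r n)
  pos : ∀ n, 0 < δ n
  succ_le : ∀ n, δ (n + 1) ≤ δ n / 2
  osc : ∀ n x z, |z - x| ≤ 2 * δ n → |r n z - r n x| ≤ (1 / 2) ^ n
  left : ∀ n x, ∃ l, x - δ n ≤ l ∧ l < x ∧ r (n + 1) l = r n l
  right : ∀ n x, ∃ l, x < l ∧ l ≤ x + δ n ∧ r (n + 1) l = r n l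

theorem IsRowSystem.reflect {r : ℕ → ℝ → ℝ} {δ : ℕ → ℝ} (h : IsRowSystem r δ) :
    IsRowSystem (fun n x => r n (-x)) δ where
  continuous n := (h.continuous n).comp continuous_neg
  pos := h.pos
  succ_le := h.succ_le
  osc n x z hz := h.osc n (-x) (-z) (by rw [← abs_neg]; convert hz using 2; ring)
  left n x := by
    obtain ⟨l, h1, h2, h3⟩ := h.right n (-x)
    exact ⟨-l, by linarith, by linarith, by simpa using h3⟩
  right n x := by
    obtain ⟨l, h1, h2, h3⟩ := h.left n (-x)
    exact ⟨-l, by linarith, by linarith, by simpa using h3⟩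

/-- If every point has, within the distance `δ n` on its left, points with the property `Q n`, then
such points can be chosen successively, descending to a limit `l`. -/
theorem exists_descending_seq {δ : ℕ → ℝ} (hpos : ∀ n, 0 < δ n) (hδ : ∀ n, δ (n + 1) ≤ δ n / 2)
    {Q : ℕ → ℝ → Prop} (hQ : ∀ n x, ∃ l, x - δ n ≤ l ∧ l < x ∧ Q n l) (n : ℕ) (x : ℝ) :
    ∃ (c : ℕ → ℝ) (l : ℝ), c 0 < x ∧ x - δ n ≤ c 0 ∧ (∀ m, l ≤ c m) ∧ Antitone c ∧
      Filter.Tendsto c Filter.atTop (nhds l) ∧ x - 2 * δ n ≤ l ∧ (∀ m, Q (n + m) (c m)) ∧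
      (∀ m, c m - δ (n + m + 1) ≤ c (m + 1)) ∧ ∀ m, c m - l ≤ 2 * δ (n + m + 1) := by
  choose L hL1 hL2 hL3 using hQ
  let c : ℕ → ℝ := fun m => Nat.rec (L n x) (fun m z => L (n + m + 1) z) m
  have c0 : c 0 = L n x := rfl
  have cs : ∀ m, c (m + 1) = L (n + m + 1) (c m) := fun m => rfl
  have hanti : Antitone c := antitone_nat_of_succ_le fun m => by rw [cs]; exact (hL2 _ _).le
  have hstep : ∀ m, c m - δ (n + m + 1) ≤ c (m + 1) := fun m => by rw [cs]; exact hL1 _ _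
  have hmono : Monotone fun m => c m - 2 * δ (n + m + 1) := monotone_nat_of_le_succ fun m => by
    have h1 := hδ (n + m + 1)
    have h2 := hstep m
    rw [show n + (m + 1) + 1 = n + m + 1 + 1 by ring]
    linarith
  have hle : ∀ k j, c k - 2 * δ (n + k + 1) ≤ c j := fun k j => by
    have h1 := hmono (le_max_left k j)
    have h2 := hanti (le_max_right k j)
    have h3 := hpos (n + max k j + 1)
    simp only at h1
    linarith
  have hbdd : BddBelow (Set.range c) := ⟨c 0 - 2 * δ (n + 0 + 1), by
    rintro _ ⟨j, rfl⟩
    exact hle 0 j⟩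
  refine ⟨c, ⨅ m, c m, hL2 _ _, hL1 _ _, fun m => ciInf_le hbdd m, hanti,
    tendsto_atTop_ciInf hanti hbdd, ?_, ?_, hstep, ?_⟩
  · refine le_ciInf fun j => ?_
    have h1 := hle 0 j
    have h2 := hL1 n x
    have h3 := hδ n
    simp only [add_zero] at h1
    rw [c0] at h1
    linarith
  · intro m
    cases m with
    | zero => exact hL3 _ _
    | succ m => rw [cs]; exact hL3 _ _
  · intro m
    rw [sub_le_comm]
    exact le_ciInf fun j => hle m j

/-- From any point `x` of row `n` a curve descends on its left to the line, along which the
extension stays close to `r n x`. It passes through agreement points of the successive stages, where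
moving from one row to the next does not change the value. -/
theorem IsRowSystem.exists_descent {r : ℕ → ℝ → ℝ} {δ : ℕ → ℝ} (h : IsRowSystem r δ) {f : ℝ → ℝ}
    (hf : ∀ x, ∀ ε > 0, ∃ᶠ n in Filter.atTop, |r n x - f x| < ε) (n : ℕ) (x : ℝ) :
    ∃ g : unitInterval → ℝ, Continuous g ∧ (∀ y, x - 2 * δ n ≤ g y ∧ g y < x) ∧
      ∀ y : unitInterval, (y : ℝ) ≤ 1 / (n + 1) →
        |stripExt r f (g y, y) - r n x| ≤ 2 * (1 / 2) ^ n := by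
  obtain ⟨c, l, hc0, hc0', hlc, hanti, hlim, hl, heq, hstep, hcl⟩ :=
    exists_descending_seq h.pos h.succ_le (Q := fun n l => r (n + 1) l = r n l) h.left n x
  have hval : ∀ m, |r (n + m) (c m) - r n x| ≤ 2 * (1 / 2) ^ n - (1 / 2) ^ (n + m) := by
    intro m
    induction m with
    | zero =>
      have := h.osc n x (c 0) (by
        have h3 := h.pos n
        rw [abs_le]
        constructor <;> linarith)
      simp only [add_zero]
      linarith
    | succ m ih =>
      have h1 := h.osc (n + m + 1) (c m) (c (m + 1)) (by
        have h1 := hstep m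
        have h2 := hanti (Nat.le_succ m)
        have h3 := h.pos (n + m + 1)
        rw [abs_le]
        constructor <;> linarith)
      rw [heq m] at h1
      have h2 : ((1 : ℝ) / 2) ^ (n + m + 1) = (1 / 2) ^ (n + m) / 2 := by rw [pow_succ]; ring
      rw [← add_assoc n m 1]
      have := abs_sub_le (r (n + m + 1) (c (m + 1))) (r (n + m) (c m)) (r n x)
      linarith
  -- The curve is itself an interpolation, of the rows that are constantly `c (k - n)`; truncated
  -- subtraction makes it constant above the row `n`.
  set s : ℕ → ℝ → ℝ := fun k _ => c (k - n) with hs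
  set g : unitInterval → ℝ := fun y => stripExt s (fun _ => l) (0, y) with hg
  have hg0 : g 0 = l := by simp [hg, stripExt]
  have hgpos : ∀ y, y ≠ 0 → g y = seqInterp (fun k => c (k - n)) (1 / (y : ℝ) - 1) :=
    fun y hy => by simp [hg, stripExt, hy, hs]
  have hmem : ∀ {y : unitInterval} {k : ℕ}, y ≠ 0 → (k : ℝ) ≤ 1 / (y : ℝ) - 1 →
      1 / (y : ℝ) - 1 ≤ k + 1 → g y ∈ Set.Icc (c (k + 1 - n)) (c (k - n)) := by
    intro y k hy h1 h2
    rw [hgpos y hy]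
    have := hanti (show k - n ≤ k + 1 - n by lia)
    exact seqInterp_mem_Icc h1 h2 ⟨this, le_rfl⟩ ⟨le_rfl, this⟩
  refine ⟨g, ?_, ?_, ?_⟩
  · rw [continuous_iff_continuousAt]
    intro y
    by_cases hy : y = 0
    · subst hy
      rw [Metric.continuousAt_iff]
      intro ε hε
      obtain ⟨K, hK⟩ := Metric.tendsto_atTop.1 hlim ε hε
      refine ⟨1 / ((n + K : ℕ) + 1), by positivity, fun {y} hy => ?_⟩
      rw [hg0]
      by_cases hy0 : y = 0
      · rw [hy0, hg0, dist_self]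
        exact hε
      obtain ⟨k, h1, h2, h4⟩ := unitInterval.exists_floor hy0
      have hk := h4 (n + K) (by
        rw [Subtype.dist_eq, Real.dist_eq] at hy
        simpa using (le_abs_self _).trans hy.le)
      have h5 := hmem hy0 h1 h2
      have h6 := hK (k - n) (by lia)
      rw [Real.dist_eq] at h6 ⊢
      rw [abs_lt] at h6 ⊢
      have := hlc (k + 1 - n)
      constructor <;> linarith [h5.1, h5.2]
    · exact ContinuousAt.comp (f := fun y : unitInterval => ((0 : ℝ), y)) (g := stripExt s _)
        (continuousAt_stripExt (fun k => continuous_const) _ hy) (by fun_prop)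
  · intro y
    by_cases hy : y = 0
    · rw [hy, hg0]
      exact ⟨hl, (hlc 0).trans_lt hc0⟩
    · obtain ⟨k, h1, h2, -⟩ := unitInterval.exists_floor hy
      have h5 := hmem hy h1 h2
      exact ⟨(hl.trans (hlc _)).trans h5.1, (h5.2.trans (hanti (Nat.zero_le _))).trans_lt hc0⟩
  · intro y hyn
    by_cases hy : y = 0
    · subst hy
      rw [hg0]
      simp only [stripExt, if_true]
      refine le_of_forall_pos_le_add fun ε hε => ?_
      obtain ⟨k, hk, hkn⟩ := ((hf l ε hε).and_eventually (Filter.eventually_ge_atTop n)).exists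
      obtain ⟨m, rfl⟩ := Nat.exists_eq_add_of_le hkn
      have h1 := h.osc (n + m) (c m) l (by
        have h1 := hcl m
        have h2 := h.succ_le (n + m)
        have h3 := hlc m
        have h4 := h.pos (n + m)
        rw [abs_le]
        constructor <;> linarith)
      have h2 := hval m
      rw [abs_le] at h1 h2 ⊢
      rw [abs_lt] at hk
      constructor <;> linarith [h1.1, h1.2, h2.1, h2.2, hk.1, hk.2]
    · obtain ⟨k, h1, h2, h4⟩ := unitInterval.exists_floor hy
      obtain ⟨m, rfl⟩ := Nat.exists_eq_add_of_le (h4 n hyn)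
      have h5 := hmem hy h1 h2
      rw [show n + m + 1 - n = m + 1 by lia, show n + m - n = m by lia] at h5
      have hd : |g y - c m| ≤ 2 * δ (n + m + 1) := by
        have h6 := hcl m
        have h7 := hlc (m + 1)
        have h8 := h.pos (n + m + 1)
        rw [abs_le]
        constructor <;> linarith [h5.1, h5.2]
      have e1 := h.osc (n + m) (c m) (g y) (hd.trans (by
        linarith [h.succ_le (n + m), h.pos (n + m)]))
      have e2 := h.osc (n + m + 1) (c m) (g y) hd
      rw [heq m] at e2
      have e3 := hval m
      have e4 : ((1 : ℝ) / 2) ^ (n + m + 1) ≤ (1 / 2) ^ (n + m) :=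
        pow_le_pow_of_le_one (by norm_num) (by norm_num) (Nat.le_succ _)
      simp only [stripExt, if_neg hy]
      have := seqInterp_mem_Icc (a := fun k => r k (g y)) (A := r n x - 2 * (1 / 2) ^ n)
        (B := r n x + 2 * (1 / 2) ^ n) h1 h2 (by
          rw [abs_le] at e1 e3
          constructor <;> linarith [e1.1, e1.2, e3.1, e3.2]) (by
          rw [abs_le] at e2 e3
          constructor <;> linarith [e2.1, e2.2, e3.1, e3.2])
      rw [abs_le]
      constructor <;> linarith [this.1, this.2]

theorem IsRowSystem.tendsto_zero {r : ℕ → ℝ → ℝ} {δ : ℕ → ℝ} (h : IsRowSystem r δ) :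
    Filter.Tendsto δ Filter.atTop (nhds 0) := by
  have hb : ∀ n, δ n ≤ δ 0 * (1 / 2) ^ n := fun n => by
    induction n with
    | zero => simp
    | succ n ih =>
      rw [pow_succ]
      linarith [h.succ_le n]
  refine squeeze_zero (fun n => (h.pos n).le) hb ?_
  simpa using (tendsto_pow_atTop_nhds_zero_of_lt_one (r := (1 / 2 : ℝ)) (by norm_num)
    (by norm_num)).const_mul (δ 0)

theorem strip_ball_union_ball_ne_univ (p q : ℝ × unitInterval) :
    Metric.ball p 1 ∪ Metric.ball q 1 ≠ Set.univ := by
  intro h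
  have : ((max p.1 q.1 + 1, 0) : ℝ × unitInterval) ∈ Metric.ball p 1 ∪ Metric.ball q 1 :=
    h ▸ Set.mem_univ _
  rcases this with h | h
  all_goals
    rw [Metric.mem_ball, Prod.dist_eq, max_lt_iff, Real.dist_eq] at h
    have h1 := (le_abs_self _).trans_lt h.1
    have h2 := le_max_left p.1 q.1
    have h3 := le_max_right p.1 q.1
    linarith

theorem unitInterval.isPreconnected_ball (y : unitInterval) (ε : ℝ) :
    IsPreconnected (Metric.ball y ε) := by
  have : Metric.ball y ε = Subtype.val ⁻¹' Metric.ball (y : ℝ) ε := rfl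
  rw [this, Real.ball_eq_Ioo]
  exact (Set.ordConnected_Ioo.preimage_mono (Subtype.mono_coe _)).isPreconnected

theorem unitInterval.isPreconnected_closedBall (y : unitInterval) (ε : ℝ) :
    IsPreconnected (Metric.closedBall y ε) := by
  have : Metric.closedBall y ε = Subtype.val ⁻¹' Metric.closedBall (y : ℝ) ε := rfl
  rw [this, Real.closedBall_eq_Icc]
  exact (Set.ordConnected_Icc.preimage_mono (Subtype.mono_coe _)).isPreconnected

/-- The region below height `t` and between two continuous curves `g₁ < g₂` is open and connected,
and its frontier is contained in the arc formed by the curves and the horizontal segment joining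
them, which is connected. -/
theorem strip_region {g₁ g₂ : unitInterval → ℝ} (h₁ : Continuous g₁) (h₂ : Continuous g₂) {x : ℝ}
    (hx₁ : ∀ y, g₁ y < x) (hx₂ : ∀ y, x < g₂ y) (t : unitInterval) (W C : Set (ℝ × unitInterval))
    (hW : W = {p | p.2 < t ∧ g₁ p.2 < p.1 ∧ p.1 < g₂ p.2})
    (hC : C = (fun y => (g₁ y, y)) '' Set.Iic t ∪ Set.Icc (g₁ t) (g₂ t) ×ˢ {t} ∪
      (fun y => (g₂ y, y)) '' Set.Iic t) :
    IsOpen W ∧ IsPreconnected W ∧ IsPreconnected C ∧ frontier W ⊆ C := by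
  have hWo : IsOpen W := by
    rw [hW]
    exact (isOpen_lt continuous_snd continuous_const).inter
      ((isOpen_lt (h₁.comp continuous_snd) continuous_fst).inter
        (isOpen_lt continuous_fst (h₂.comp continuous_snd)))
  refine ⟨hWo, ?_, ?_, ?_⟩
  · refine isPreconnected_of_forall (x, 0) fun p hp => ?_
    rw [hW] at hp
    obtain ⟨hp1, hp2, hp3⟩ := hp
    refine ⟨Set.uIcc x p.1 ×ˢ {p.2} ∪ {x} ×ˢ Set.Iic p.2, ?_, Or.inr ⟨rfl, p.2.2.1⟩,
      Or.inl ⟨Set.right_mem_uIcc, rfl⟩, ?_⟩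
    · rw [hW]
      rintro ⟨z, y⟩ (⟨hz, rfl⟩ | ⟨rfl, hy⟩)
      · have : min x p.1 ≤ z ∧ z ≤ max x p.1 := hz
        exact ⟨hp1, (lt_min (hx₁ _) hp2).trans_le this.1, this.2.trans_lt (max_lt (hx₂ _) hp3)⟩
      · exact ⟨lt_of_le_of_lt hy hp1, hx₁ _, hx₂ _⟩
    · exact (isPreconnected_uIcc.prod isPreconnected_singleton).union (x, p.2)
        ⟨Set.left_mem_uIcc, rfl⟩ ⟨rfl, Set.mem_Iic.2 le_rfl⟩
        (isPreconnected_singleton.prod isPreconnected_Iic)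
  · have hlt : g₁ t ≤ g₂ t := ((hx₁ t).trans (hx₂ t)).le
    have c1 : IsPreconnected ((fun y => (g₁ y, y)) '' Set.Iic t) :=
      isPreconnected_Iic.image _ (by fun_prop)
    have c2 : IsPreconnected ((fun y => (g₂ y, y)) '' Set.Iic t) :=
      isPreconnected_Iic.image _ (by fun_prop)
    rw [hC]
    refine IsPreconnected.union (g₂ t, t) (Or.inr ⟨⟨hlt, le_rfl⟩, rfl⟩) ⟨t, le_refl t, rfl⟩ ?_ c2
    exact c1.union (g₁ t, t) ⟨t, le_refl t, rfl⟩ ⟨⟨le_rfl, hlt⟩, rfl⟩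
      (isPreconnected_Icc.prod isPreconnected_singleton)
  · intro p hp
    have hcl : closure W ⊆ {p | p.2 ≤ t ∧ g₁ p.2 ≤ p.1 ∧ p.1 ≤ g₂ p.2} := by
      refine closure_minimal ?_ ((isClosed_le continuous_snd continuous_const).inter
        ((isClosed_le (h₁.comp continuous_snd) continuous_fst).inter
          (isClosed_le continuous_fst (h₂.comp continuous_snd))))
      rw [hW]
      exact fun q hq => ⟨hq.1.le, hq.2.1.le, hq.2.2.le⟩
    obtain ⟨e1, e2, e3⟩ := hcl hp.1
    have hnot : p ∉ W := fun h => hp.2 (by rwa [hWo.interior_eq])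
    rw [hC]
    rcases e1.lt_or_eq with h1 | h1
    · rcases e2.lt_or_eq with h2 | h2
      · rcases e3.lt_or_eq with h3 | h3
        · exact absurd (hW ▸ ⟨h1, h2, h3⟩) hnot
        · exact Or.inr ⟨p.2, e1, Prod.ext h3.symm rfl⟩
      · exact Or.inl (Or.inl ⟨p.2, e1, Prod.ext h2 rfl⟩)
    · rw [h1] at e2 e3
      exact Or.inl (Or.inr ⟨⟨e2, e3⟩, h1⟩)

/-- A function is extendable as soon as, at every point `x`, its value is a cluster point of the
sequence of values at `x` of the rows of a row system. -/
theorem IsRowSystem.isExtendable {r : ℕ → ℝ → ℝ} {δ : ℕ → ℝ} (h : IsRowSystem r δ) {f : ℝ → ℝ}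
    (hf : ∀ x, ∀ ε > 0, ∃ᶠ n in Filter.atTop, |r n x - f x| < ε) : IsExtendable f := by
  refine ⟨stripExt r f, isConnectivity_of_cells strip_ball_union_ball_ne_univ ?_,
    fun x => by simp [stripExt]⟩
  rintro ⟨x, y⟩ ε hε
  by_cases hy : y = 0
  · subst hy
    have ev1 : ∀ᶠ n in Filter.atTop, 2 * δ n < ε :=
      (by simpa using h.tendsto_zero.const_mul 2 : Filter.Tendsto (fun n => 2 * δ n) _ _)
        |>.eventually_lt_const hε
    have ev2 : ∀ᶠ n : ℕ in Filter.atTop, 2 * ((1 : ℝ) / 2) ^ n < ε / 2 :=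
      (by simpa using (tendsto_pow_atTop_nhds_zero_of_lt_one (r := (1 / 2 : ℝ)) (by norm_num)
        (by norm_num)).const_mul 2 : Filter.Tendsto (fun n : ℕ => 2 * ((1 : ℝ) / 2) ^ n) _ _)
        |>.eventually_lt_const (half_pos hε)
    have ev3 : ∀ᶠ n : ℕ in Filter.atTop, 1 / ((n : ℝ) + 1) < ε :=
      tendsto_one_div_add_atTop_nhds_zero_nat.eventually_lt_const hε
    obtain ⟨n, hn, hn1, hn2, hn3⟩ :=
      ((hf x (ε / 2) (half_pos hε)).and_eventually (ev1.and (ev2.and ev3))).exists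
    -- The neighbourhood of `(x, 0)` lies below the row `n`, between a curve descending on the left
    -- of `x` and, by reflection, one descending on its right.
    obtain ⟨g₁, hg₁, hgx₁, hgF₁⟩ := h.exists_descent hf n x
    obtain ⟨g₂, hg₂, hgx₂, hgF₂⟩ := h.reflect.exists_descent (f := fun x => f (-x))
      (fun x => hf (-x)) n (-x)
    set t : unitInterval := ⟨1 / ((n : ℝ) + 1), by positivity, by
      rw [div_le_one (by positivity)]; linarith [(Nat.cast_nonneg n : (0 : ℝ) ≤ n)]⟩ with ht
    have ht0 : t ≠ 0 := fun h => by
      have := congrArg Subtype.val h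
      simp only [ht] at this
      exact absurd this (by positivity)
    obtain ⟨w1, w2, w3, w4⟩ := strip_region (g₂ := fun y => -g₂ y) hg₁ hg₂.neg (x := x)
      (fun y => (hgx₁ y).2) (fun y => by linarith [(hgx₂ y).2]) t _ _ rfl rfl
    have hsmall : ∀ p : ℝ × unitInterval, p.2 ≤ t → g₁ p.2 ≤ p.1 → p.1 ≤ -g₂ p.2 →
        p ∈ Metric.ball ((x, 0) : ℝ × unitInterval) ε := by
      intro p hp h1 h2
      rw [Metric.mem_ball, Prod.dist_eq, max_lt_iff, Real.dist_eq, Subtype.dist_eq, Real.dist_eq]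
      constructor
      · rw [abs_lt]
        constructor <;> linarith [hgx₁ p.2, hgx₂ p.2]
      · have hp' : (p.2 : ℝ) ≤ 1 / ((n : ℝ) + 1) := hp
        simp only [Set.Icc.coe_zero, sub_zero]
        rw [abs_of_nonneg p.2.2.1]
        linarith
    refine ⟨_, _, w1, ⟨?_, (hgx₁ _).2, ?_⟩, w2, ?_, w3, w4, ?_, ?_⟩
    · exact unitInterval.pos_iff_ne_zero.2 ht0
    · have := (hgx₂ 0).2
      show x < - g₂ 0
      linarith
    · rintro p ⟨h1, h2, h3⟩
      exact hsmall p h1.le h2.le h3.le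
    · rintro p ((⟨y, hy, rfl⟩ | ⟨⟨h1, h2⟩, h3⟩) | ⟨y, hy, rfl⟩)
      · exact hsmall _ hy le_rfl (by show g₁ y ≤ -g₂ y; linarith [(hgx₁ y).2, (hgx₂ y).2])
      · have h3 : p.2 = t := h3
        exact hsmall p h3.le (by rwa [h3]) (by rwa [h3])
      · exact hsmall _ hy (by show g₁ y ≤ -g₂ y; linarith [(hgx₁ y).2, (hgx₂ y).2]) le_rfl
    · have hfx : stripExt r f (x, 0) = f x := by simp [stripExt]
      have key : ∀ a : ℝ, |a - r n x| ≤ 2 * (1 / 2) ^ n → |a - f x| < ε := by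
        intro a ha
        have := abs_sub_le a (r n x) (f x)
        linarith
      rw [hfx]
      rintro p ((⟨y, hy, rfl⟩ | ⟨⟨h1, h2⟩, h3⟩) | ⟨y, hy, rfl⟩)
      · exact key _ (hgF₁ y hy)
      · have h3 : p.2 = t := h3
        refine key _ ?_
        have hτ : 1 / ((t : unitInterval) : ℝ) - 1 = n := by simp [ht]
        rw [stripExt, if_neg (by rwa [h3]), h3, hτ, seqInterp_of_mem _ le_rfl (by linarith)]
        simp only [sub_self, zero_mul, add_zero]
        have := h.osc n x p.1 (by
          rw [abs_le]
          constructor <;> linarith [hgx₁ t, hgx₂ t])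
        have h5 : (0 : ℝ) ≤ (1 / 2) ^ n := by positivity
        linarith
      · refine key _ ?_
        have := hgF₂ y hy
        simpa [stripExt] using this
  · obtain ⟨η, hη, hηF⟩ := Metric.continuousAt_iff.1
      (continuousAt_stripExt h.continuous f (p := (x, y)) hy) ε hε
    have hlt : min η ε / 2 < min η ε := half_lt_self (lt_min hη hε)
    refine ⟨Metric.ball (x, y) (min η ε / 2), Metric.closedBall (x, y) (min η ε / 2),
      Metric.isOpen_ball, Metric.mem_ball_self (half_pos (lt_min hη hε)), ?_, ?_, ?_,
      Metric.frontier_ball_subset_sphere.trans Metric.sphere_subset_closedBall, ?_, ?_⟩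
    · rw [← ball_prod_same]
      exact ((convex_ball x _).isPreconnected).prod (unitInterval.isPreconnected_ball y _)
    · exact Metric.ball_subset_ball (hlt.le.trans (min_le_right _ _))
    · rw [← closedBall_prod_same]
      exact ((convex_closedBall x _).isPreconnected).prod
        (unitInterval.isPreconnected_closedBall y _)
    · exact Metric.closedBall_subset_ball (hlt.trans_le (min_le_right _ _))
    · intro c hc
      rw [← Real.dist_eq]
      exact hηF ((Metric.closedBall_subset_ball (hlt.trans_le (min_le_left _ _))) hc)

/-! ### Concrete row systems -/

/-- The scales `1, 1 / 16, …`, decreasing fast enough for each row to be nearly constant at its own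
scale. -/
noncomputable def scale : ℕ → ℝ
  | 0 => 1
  | n + 1 => scale n / (16 * 8 ^ n)

theorem scale_pos (n : ℕ) : 0 < scale n := by
  induction n with
  | zero => exact one_pos
  | succ n ih => rw [scale]; positivity

theorem scale_succ_le (n : ℕ) : scale (n + 1) ≤ scale n / 2 := by
  rw [scale]
  have h8 : (1 : ℝ) ≤ 8 ^ n := one_le_pow₀ (by norm_num)
  exact div_le_div_of_nonneg_left (scale_pos n).le (by norm_num) (by linarith)

theorem two_mul_scale_succ_lt (n : ℕ) : 2 * scale (n + 1) < scale n / 2 ^ n := by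
  rw [scale, mul_div_assoc', div_lt_div_iff₀ (by positivity) (by positivity)]
  have h2 : (2 : ℝ) ^ n ≤ 8 ^ n := pow_le_pow_left₀ (by norm_num) (by norm_num) n
  have h8 : (0 : ℝ) < 8 ^ n := by positivity
  nlinarith [scale_pos n]

/-- The distance from `x` to the points `(k + s) * scale n`, `k ∈ ℤ`, in units of
`scale n / 2 ^ n`. -/
noncomputable def phaseDist (s : ℝ) (n : ℕ) (x : ℝ) : ℝ :=
  Metric.infDist x (Set.range fun k : ℤ => (k + s) * scale n) / (scale n / 2 ^ n)

theorem phaseDist_nonneg (s : ℝ) (n : ℕ) (x : ℝ) : 0 ≤ phaseDist s n x :=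
  div_nonneg Metric.infDist_nonneg (div_pos (scale_pos n) (by positivity)).le

theorem phaseDist_core (s : ℝ) (n : ℕ) (k : ℤ) : phaseDist s n ((k + s) * scale n) = 0 := by
  have h : (k + s) * scale n ∈ Set.range fun k : ℤ => (k + s) * scale n := ⟨k, rfl⟩
  rw [phaseDist, Metric.infDist_zero_of_mem h, zero_div]

theorem abs_phaseDist_sub_le (s : ℝ) (n : ℕ) (x z : ℝ) :
    |phaseDist s n z - phaseDist s n x| ≤ 2 ^ n / scale n * |z - x| := by
  have h := (Metric.lipschitz_infDist_pt
    (Set.range fun k : ℤ => (k + s) * scale n)).dist_le_mul z x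
  rw [Real.dist_eq, Real.dist_eq, NNReal.coe_one, one_mul] at h
  have hp := scale_pos n
  rw [phaseDist, phaseDist, ← sub_div, abs_div, abs_of_pos (a := scale n / 2 ^ n) (by positivity),
    div_le_iff₀ (by positivity)]
  refine h.trans (le_of_eq ?_)
  field_simp

theorem phaseDist_lt_iff {s : ℝ} {n : ℕ} {x c : ℝ} :
    phaseDist s n x < c ↔ ∃ k : ℤ, |x - (k + s) * scale n| < c * (scale n / 2 ^ n) := by
  have hp := scale_pos n
  rw [phaseDist, div_lt_iff₀ (by positivity), Metric.infDist_lt_iff (Set.range_nonempty _)]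
  simp [Real.dist_eq]

theorem exists_core_left (s : ℝ) (n : ℕ) (x : ℝ) :
    ∃ l, x - scale n ≤ l ∧ l < x ∧ phaseDist s n l = 0 := by
  have hp := scale_pos n
  refine ⟨((⌈x / scale n - s⌉ - 1 : ℤ) + s) * scale n, ?_, ?_, phaseDist_core _ _ _⟩
  · have h := (sub_le_iff_le_add.1 (Int.le_ceil (x / scale n - s)))
    rw [div_le_iff₀ hp] at h
    push_cast
    linarith
  · have h := Int.ceil_lt_add_one (x / scale n - s)
    have h' : ((⌈x / scale n - s⌉ - 1 : ℤ) + s) < x / scale n := by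
      push_cast
      linarith
    exact (lt_div_iff₀ hp).1 h'

theorem exists_core_right (s : ℝ) (n : ℕ) (x : ℝ) :
    ∃ l, x < l ∧ l ≤ x + scale n ∧ phaseDist s n l = 0 := by
  have hp := scale_pos n
  refine ⟨((⌊x / scale n - s⌋ + 1 : ℤ) + s) * scale n, ?_, ?_, phaseDist_core _ _ _⟩
  · have h := Int.lt_floor_add_one (x / scale n - s)
    have h' : x / scale n < ((⌊x / scale n - s⌋ + 1 : ℤ) + s) := by
      push_cast
      linarith
    exact (div_lt_iff₀ hp).1 h'
  · have h := le_sub_iff_add_le.1 (Int.floor_le (x / scale n - s))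
    rw [le_div_iff₀ hp] at h
    push_cast
    linarith

/-- The cut-off function vanishing on `(-∞, 1]` and equal to `1` on `[2, ∞)`. -/
noncomputable def ramp (u : ℝ) : ℝ := max 0 (min (u - 1) 1)

theorem ramp_nonneg (u : ℝ) : 0 ≤ ramp u := le_max_left _ _

theorem ramp_le_one (u : ℝ) : ramp u ≤ 1 := max_le zero_le_one (min_le_right _ _)

theorem ramp_of_le {u : ℝ} (h : u ≤ 1) : ramp u = 0 :=
  max_eq_left ((min_le_left _ _).trans (by linarith))

theorem ramp_of_ge {u : ℝ} (h : 2 ≤ u) : ramp u = 1 := by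
  rw [ramp, min_eq_right (by linarith), max_eq_right zero_le_one]

theorem abs_min_one_sub_le (u v : ℝ) : |min u 1 - min v 1| ≤ |u - v| := by
  simpa using abs_min_sub_min_le_max u 1 v 1

theorem abs_ramp_sub_le (u v : ℝ) : |ramp u - ramp v| ≤ |u - v| := by
  have h1 := abs_max_sub_max_le_max 0 (min (u - 1) 1) 0 (min (v - 1) 1)
  have h2 := abs_min_sub_min_le_max (u - 1) 1 (v - 1) 1
  simp only [sub_self, abs_zero, sub_sub_sub_cancel_right] at h1 h2
  rw [max_eq_left (abs_nonneg _)] at h2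
  rw [max_eq_right (abs_nonneg (min (u - 1) 1 - min (v - 1) 1))] at h1
  exact h1.trans h2

/-- The rows with phase `s`. The stage `n` leaves the row unchanged at the points with
`phaseDist s n x = 0`, multiplies it by `1 - phaseDist s n x` where this distance is at most `1`,
and replaces it by `a n` where the phase distances of this stage and of the preceding one are both
at least `2`; in between, cut-off functions are used. The truncation of `n - 1` at the stage `0` is
harmless, as `a 0` will be `0`. -/
noncomputable def row (a : ℕ → ℝ) (s : ℝ) : ℕ → ℝ → ℝ
  | 0, _ => 0
  | n + 1, x => (1 - min (phaseDist s n x) 1) * row a s n x +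
      a n * (ramp (phaseDist s n x) * ramp (phaseDist s (n - 1) x))

theorem row_succ (a : ℕ → ℝ) (s : ℝ) (n : ℕ) (x : ℝ) :
    row a s (n + 1) x = (1 - min (phaseDist s n x) 1) * row a s n x +
      a n * (ramp (phaseDist s n x) * ramp (phaseDist s (n - 1) x)) := rfl

theorem row_succ_of_le (a : ℕ → ℝ) {s : ℝ} {n : ℕ} {x : ℝ} (h : phaseDist s n x ≤ 1) :
    row a s (n + 1) x = (1 - phaseDist s n x) * row a s n x := by
  rw [row_succ, ramp_of_le h, min_eq_left h]
  ring

theorem row_succ_of_ge (a : ℕ → ℝ) {s : ℝ} {n : ℕ} {x : ℝ} (h : 1 ≤ phaseDist s n x) :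
    row a s (n + 1) x = a n * (ramp (phaseDist s n x) * ramp (phaseDist s (n - 1) x)) := by
  rw [row_succ, min_eq_right h]
  ring

theorem abs_row_le {a : ℕ → ℝ} (ha : ∀ n, |a n| ≤ n) (s : ℝ) (n : ℕ) (x : ℝ) :
    |row a s n x| ≤ n := by
  induction n with
  | zero => simp [row]
  | succ n ih =>
    push_cast
    have h0 := phaseDist_nonneg s n x
    rcases le_total (phaseDist s n x) 1 with h | h
    · rw [row_succ_of_le a h, abs_mul, abs_of_nonneg (by linarith)]
      have := mul_le_mul_of_nonneg_right (show 1 - phaseDist s n x ≤ 1 by linarith)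
        (abs_nonneg (row a s n x))
      linarith
    · rw [row_succ_of_ge a h, abs_mul, abs_of_nonneg (a := ramp _ * ramp _)
        (mul_nonneg (ramp_nonneg _) (ramp_nonneg _))]
      have h1 := mul_le_one₀ (ramp_le_one (phaseDist s n x)) (ramp_nonneg _)
        (ramp_le_one (phaseDist s (n - 1) x))
      have h2 := mul_le_mul_of_nonneg_left h1 (abs_nonneg (a n))
      linarith [ha n]

theorem two_pow_div_scale_mono : Monotone fun n => 2 ^ n / scale n := by
  refine monotone_nat_of_le_succ fun n => ?_
  have h1 := scale_succ_le n
  have h2 := scale_pos n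
  refine div_le_div₀ (by positivity) (pow_le_pow_right₀ (by norm_num) (Nat.le_succ n))
    (scale_pos _) (by linarith)

theorem abs_row_sub_le {a : ℕ → ℝ} (ha : ∀ n, |a n| ≤ n) (s : ℝ) (n : ℕ) (x z : ℝ) :
    |row a s n z - row a s n x| ≤ (1 / 2) ^ (n + 1) / scale n * |z - x| := by
  induction n with
  | zero =>
    have := scale_pos 0
    simp only [row, sub_self, abs_zero]
    positivity
  | succ n ih =>
    have hp := scale_pos n
    set K := 2 ^ n / scale n * |z - x| with hK
    have hK' : 2 ^ (n - 1) / scale (n - 1) * |z - x| ≤ K :=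
      mul_le_mul_of_nonneg_right (two_pow_div_scale_mono (Nat.sub_le n 1)) (abs_nonneg _)
    have hK0 : 0 ≤ K := by positivity
    have hn : (n : ℝ) ≤ 2 ^ n := by exact_mod_cast Nat.lt_two_pow_self.le
    have hn0 : (0 : ℝ) ≤ n := Nat.cast_nonneg n
    have b1 := (abs_min_one_sub_le _ _).trans (abs_phaseDist_sub_le s n x z)
    have b2 := (abs_ramp_sub_le _ _).trans (abs_phaseDist_sub_le s n x z)
    have b3 := ((abs_ramp_sub_le _ _).trans (abs_phaseDist_sub_le s (n - 1) x z)).trans hK'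
    have b4 := abs_row_le ha s n x
    have b5 : |1 - min (phaseDist s n z) 1| ≤ 1 := by
      have := le_min (phaseDist_nonneg s n z) zero_le_one
      rw [abs_le]
      constructor <;> linarith [min_le_right (phaseDist s n z) 1]
    have b6 : |ramp (phaseDist s n z)| ≤ 1 := by
      rw [abs_of_nonneg (ramp_nonneg _)]; exact ramp_le_one _
    have b7 : |ramp (phaseDist s (n - 1) x)| ≤ 1 := by
      rw [abs_of_nonneg (ramp_nonneg _)]; exact ramp_le_one _
    have hdecomp : row a s (n + 1) z - row a s (n + 1) x =
        (1 - min (phaseDist s n z) 1) * (row a s n z - row a s n x)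
        - (min (phaseDist s n z) 1 - min (phaseDist s n x) 1) * row a s n x
        + a n * (ramp (phaseDist s n z) *
            (ramp (phaseDist s (n - 1) z) - ramp (phaseDist s (n - 1) x))
          + (ramp (phaseDist s n z) - ramp (phaseDist s n x)) * ramp (phaseDist s (n - 1) x)) := by
      rw [row_succ, row_succ]
      ring
    have t1 : |(1 - min (phaseDist s n z) 1) * (row a s n z - row a s n x)| ≤
        (1 / 2) ^ (n + 1) / scale n * |z - x| := by
      rw [abs_mul]
      exact (mul_le_of_le_one_left (abs_nonneg _) b5).trans ih
    have t2 : |(min (phaseDist s n z) 1 - min (phaseDist s n x) 1) * row a s n x| ≤ K * 2 ^ n := by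
      rw [abs_mul]
      exact mul_le_mul b1 (b4.trans hn) (abs_nonneg _) hK0
    have t3 : |ramp (phaseDist s n z) *
            (ramp (phaseDist s (n - 1) z) - ramp (phaseDist s (n - 1) x))| ≤ K := by
      rw [abs_mul]
      exact (mul_le_of_le_one_left (abs_nonneg _) b6).trans b3
    have t4 : |(ramp (phaseDist s n z) - ramp (phaseDist s n x)) *
        ramp (phaseDist s (n - 1) x)| ≤ K := by
      rw [abs_mul]
      exact (mul_le_of_le_one_right (abs_nonneg _) b7).trans b2
    have t5 : |a n * (ramp (phaseDist s n z) *
            (ramp (phaseDist s (n - 1) z) - ramp (phaseDist s (n - 1) x))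
          + (ramp (phaseDist s n z) - ramp (phaseDist s n x)) * ramp (phaseDist s (n - 1) x))| ≤
        2 ^ n * (K + K) := by
      rw [abs_mul]
      exact mul_le_mul ((ha n).trans hn) ((abs_add_le _ _).trans (add_le_add t3 t4))
        (abs_nonneg _) (by positivity)
    have hfin : (1 / 2) ^ (n + 1) / scale n * |z - x| + K * 2 ^ n + 2 ^ n * (K + K) ≤
        (1 / 2) ^ (n + 1 + 1) / scale (n + 1) * |z - x| := by
      have e8 : (8 : ℝ) ^ n = 2 ^ n * (2 ^ n * 2 ^ n) := by
        rw [← mul_pow, ← mul_pow]; norm_num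
      have e1 : (1 : ℝ) ≤ 2 ^ n * 2 ^ n := by
        rw [← mul_pow]; exact one_le_pow₀ (by norm_num)
      have e2 : (1 / 2 : ℝ) ^ n * 2 ^ n = 1 := by rw [← mul_pow]; norm_num
      have e3 : (1 / 2 : ℝ) ^ n ≤ 1 := pow_le_one₀ (by norm_num) (by norm_num)
      have hc : (1 / 2 : ℝ) ^ (n + 1) + 3 * (2 ^ n * 2 ^ n) ≤ 4 * (2 ^ n * 2 ^ n) := by
        rw [pow_succ]; linarith
      have hL : (1 / 2) ^ (n + 1) / scale n * |z - x| + K * 2 ^ n + 2 ^ n * (K + K) =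
          ((1 / 2 : ℝ) ^ (n + 1) + 3 * (2 ^ n * 2 ^ n)) * (|z - x| / scale n) := by
        rw [hK]; field_simp; ring
      have hR : (1 / 2) ^ (n + 1 + 1) / scale (n + 1) * |z - x| =
          4 * (2 ^ n * 2 ^ n) * (|z - x| / scale n) := by
        rw [scale, e8, pow_succ, pow_succ]
        have : (1 / 2 : ℝ) ^ n * (1 / 2) * (1 / 2) / (scale n / (16 * (2 ^ n * (2 ^ n * 2 ^ n)))) *
          |z - x| = 4 * ((1 / 2) ^ n * 2 ^ n) * (2 ^ n * 2 ^ n) * (|z - x| / scale n) := by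
          field_simp; ring
        rw [this, e2, mul_one]
      rw [hL, hR]
      exact mul_le_mul_of_nonneg_right hc (by positivity)
    rw [hdecomp]
    refine (abs_add_le _ _).trans
      ((add_le_add ((abs_sub _ _).trans (add_le_add t1 t2)) t5).trans ?_)
    linarith

theorem isRowSystem_row {a : ℕ → ℝ} (ha : ∀ n, |a n| ≤ n) (s : ℝ) :
    IsRowSystem (row a s) scale where
  continuous n := by
    have hp := scale_pos n
    have hL : LipschitzWith ⟨(1 / 2) ^ (n + 1) / scale n, by positivity⟩ (row a s n) :=
      LipschitzWith.of_dist_le_mul fun z x => abs_row_sub_le ha s n x z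
    exact hL.continuous
  pos := scale_pos
  succ_le := scale_succ_le
  osc n x z h := by
    refine (abs_row_sub_le ha s n x z).trans ?_
    have hp := scale_pos n
    refine (mul_le_mul_of_nonneg_left h (by positivity)).trans (le_of_eq ?_)
    rw [pow_succ]
    field_simp
  left n x := by
    obtain ⟨l, h1, h2, h3⟩ := exists_core_left s n x
    exact ⟨l, h1, h2, by rw [row_succ_of_le a (by simp [h3]), h3]; ring⟩
  right n x := by
    obtain ⟨l, h1, h2, h3⟩ := exists_core_right s n x
    exact ⟨l, h1, h2, by rw [row_succ_of_le a (by simp [h3]), h3]; ring⟩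

/-! ### Limits of the rows -/

/-- The points that are close to the agreement points with phase `s` at all late stages. -/
def tailSet (s : ℝ) : Set ℝ := {x | ∀ᶠ n in Filter.atTop, phaseDist s n x < 1}

/-- For distinct phases `s` and `t`, the points of `tailSet t` are at all late stages far from the
agreement points with phase `s`. -/
theorem eventually_two_le_phaseDist {s t x : ℝ} (hs : s ∈ Set.Ioo (0 : ℝ) (1 / 2))
    (ht : t ∈ Set.Ioo (0 : ℝ) (1 / 2)) (hst : s ≠ t) (hx : x ∈ tailSet t) :
    ∀ᶠ n in Filter.atTop, 2 ≤ phaseDist s n x := by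
  have hd : 0 < |t - s| := abs_pos.2 (sub_ne_zero.2 hst.symm)
  have hlim : Filter.Tendsto (fun n : ℕ => 3 * (1 / 2 : ℝ) ^ n) Filter.atTop (nhds 0) := by
    simpa using (tendsto_pow_atTop_nhds_zero_of_lt_one (r := (1 / 2 : ℝ)) (by norm_num)
      (by norm_num)).const_mul 3
  filter_upwards [hx, hlim.eventually_lt_const hd] with n hn hn'
  have hp := scale_pos n
  obtain ⟨k, hk⟩ := phaseDist_lt_iff.1 hn
  by_contra! hcon
  obtain ⟨j, hj⟩ := phaseDist_lt_iff.1 hcon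
  have h1 : |(k - j : ℤ) + (t - s)| * scale n < 3 * (1 / 2) ^ n * scale n := by
    have e : ((k - j : ℤ) + (t - s)) * scale n =
        (x - (j + s) * scale n) - (x - (k + t) * scale n) := by push_cast; ring
    rw [← abs_of_pos hp, ← abs_mul, abs_of_pos hp, e]
    refine (abs_sub _ _).trans_lt ((add_lt_add hj hk).trans_eq ?_)
    rw [one_div, inv_pow]
    field_simp
    ring
  have h2 := (lt_of_mul_lt_mul_right h1 hp.le).trans hn'
  have h3 : |t - s| ≤ 1 / 2 := by
    rw [abs_le]
    constructor <;> linarith [hs.1, hs.2, ht.1, ht.2]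
  by_cases hkj : k - j = 0
  · rw [hkj, Int.cast_zero, zero_add] at h2
    exact lt_irrefl _ h2
  · have h4 : (1 : ℝ) ≤ |((k - j : ℤ) : ℝ)| := by exact_mod_cast Int.one_le_abs hkj
    have h5 := abs_sub_abs_le_abs_sub ((k - j : ℤ) : ℝ) (-(t - s))
    rw [sub_neg_eq_add, abs_neg] at h5
    linarith

theorem disjoint_tailSet {s t : ℝ} (hs : s ∈ Set.Ioo (0 : ℝ) (1 / 2))
    (ht : t ∈ Set.Ioo (0 : ℝ) (1 / 2)) (hst : s ≠ t) : Disjoint (tailSet s) (tailSet t) := by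
  refine Set.disjoint_left.2 fun x hxs hxt => ?_
  obtain ⟨n, h1, h2⟩ := (hxs.and (eventually_two_le_phaseDist hs ht hst hxt)).exists
  linarith

theorem dense_tailSet (s : ℝ) : Dense (tailSet s) := by
  rw [Metric.dense_iff]
  intro x ε hε
  have hz := (isRowSystem_row (a := fun _ => 0) (fun n => by simp) s).tendsto_zero.const_mul 2
  rw [mul_zero] at hz
  obtain ⟨n, hn⟩ := (hz.eventually_lt_const hε).exists
  obtain ⟨c, l, hc0, -, hlc, -, -, hl, hQ, -, hcl⟩ := exists_descending_seq scale_pos scale_succ_le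
    (exists_core_left s) n x
  refine ⟨l, ?_, ?_⟩
  · rw [Metric.mem_ball, Real.dist_eq, abs_lt]
    constructor <;> linarith [hlc 0]
  · filter_upwards [Filter.eventually_ge_atTop n] with k hk
    obtain ⟨m, rfl⟩ := Nat.exists_eq_add_of_le hk
    have h1 := abs_phaseDist_sub_le s (n + m) (c m) l
    have hp := scale_pos (n + m)
    rw [hQ m, sub_zero, abs_of_nonneg (phaseDist_nonneg _ _ _), abs_sub_comm,
      abs_of_nonneg (sub_nonneg.2 (hlc m))] at h1
    refine h1.trans_lt ?_
    have h2 := (hcl m).trans_lt (two_mul_scale_succ_lt (n + m))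
    rw [lt_div_iff₀ (by positivity)] at h2
    rw [div_mul_eq_mul_div, div_lt_one hp, mul_comm]
    exact h2

/-- On `tailSet s` the late stages only multiply the row by numbers in `[0, 1]`. -/
theorem exists_tendsto_row (a : ℕ → ℝ) {s x : ℝ} (hx : x ∈ tailSet s) :
    ∃ L, Filter.Tendsto (fun n => row a s n x) Filter.atTop (nhds L) := by
  obtain ⟨N, hN⟩ := Filter.eventually_atTop.1 hx
  set p : ℕ → ℝ := fun k => ∏ i ∈ Finset.range k, (1 - phaseDist s (i + N) x) with hp
  have hfac : ∀ i, 0 ≤ 1 - phaseDist s (i + N) x := fun i => by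
    linarith [hN (i + N) (Nat.le_add_left _ _)]
  have hp0 : ∀ k, 0 ≤ p k := fun k => Finset.prod_nonneg fun i _ => hfac i
  have hanti : Antitone p := antitone_nat_of_succ_le fun k => by
    simp only [hp, Finset.prod_range_succ]
    exact mul_le_of_le_one_right (hp0 k) (by linarith [phaseDist_nonneg s (k + N) x])
  have hrow : ∀ k, row a s (k + N) x = p k * row a s N x := fun k => by
    induction k with
    | zero => simp [hp]
    | succ k ih =>
      rw [show k + 1 + N = k + N + 1 by ring,
        row_succ_of_le a (hN (k + N) (Nat.le_add_left _ _)).le, ih]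
      simp only [hp, Finset.prod_range_succ]
      ring
  refine ⟨(⨅ k, p k) * row a s N x, (Filter.tendsto_add_atTop_iff_nat N).1 ?_⟩
  simp only [hrow]
  exact (tendsto_atTop_ciInf hanti ⟨0, by rintro _ ⟨k, rfl⟩; exact hp0 k⟩).mul_const _

/-- Outside `tailSet s` the row is reset to `0` infinitely often. This uses that even stages have
the target `0`: an odd stage moves the row towards a nonzero target only where the preceding even
stage has reset it. -/
theorem frequently_row_eq_zero {a : ℕ → ℝ} (ha : ∀ n, a (2 * n) = 0) {s x : ℝ}
    (hx : x ∉ tailSet s) : ∃ᶠ n in Filter.atTop, row a s n x = 0 := by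
  rw [Filter.frequently_atTop]
  intro N
  have hx' : ∃ᶠ n in Filter.atTop, 1 ≤ phaseDist s n x := by
    simpa [tailSet, Filter.Frequently] using hx
  obtain ⟨n, hn, hn1⟩ := Filter.frequently_atTop.1 hx' (N + 1)
  have heven : ∀ m, Even m → 1 ≤ phaseDist s m x → row a s (m + 1) x = 0 := by
    rintro m ⟨k, rfl⟩ h
    rw [row_succ_of_ge a h, ← two_mul, ha, zero_mul]
  rcases Nat.even_or_odd n with he | ⟨k, rfl⟩
  · exact ⟨n + 1, by lia, heven n he hn1⟩
  · rcases le_total 1 (phaseDist s (2 * k) x) with h | h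
    · exact ⟨2 * k + 1, by lia, heven _ (even_two_mul k) h⟩
    · refine ⟨2 * k + 1 + 1, by lia, ?_⟩
      rw [row_succ_of_ge a hn1, Nat.add_sub_cancel, ramp_of_le h]
      ring

theorem row_succ_of_two_le (a : ℕ → ℝ) {s : ℝ} {n : ℕ} {x : ℝ} (h : 2 ≤ phaseDist s (n + 1) x)
    (h' : 2 ≤ phaseDist s n x) : row a s (n + 2) x = a (n + 1) := by
  rw [row_succ_of_ge a (by linarith), ramp_of_ge h, Nat.add_sub_cancel, ramp_of_ge h']
  ring

/-- Targets for the rows: `0` at even stages, and at odd stages a sequence that comes back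
infinitely often to every element of a countable dense set, while growing at most linearly. -/
theorem exists_targets : ∃ a : ℕ → ℝ, (∀ n, |a n| ≤ n) ∧ (∀ n, a (2 * n) = 0) ∧
    ∀ y : ℝ, ∀ ε > 0, ∃ᶠ n in Filter.atTop, |a (2 * n + 1) - y| < ε := by
  classical
  let q := TopologicalSpace.denseSeq ℝ
  let v : ℕ → ℝ := fun n => q (Nat.unpair (n / 2)).1
  refine ⟨fun n => if Odd n ∧ |v n| ≤ n then v n else 0, fun n => ?_, fun n => ?_,
    fun y ε hε => ?_⟩
  · beta_reduce
    split_ifs with h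
    · exact h.2
    · simp
  · simp
  · obtain ⟨_, hi, i, rfl⟩ :=
      (TopologicalSpace.denseRange_denseSeq ℝ).inter_open_nonempty _ Metric.isOpen_ball
        ⟨y, Metric.mem_ball_self hε⟩
    rw [Filter.frequently_atTop]
    intro N
    obtain ⟨j, hj⟩ := exists_nat_ge |q i|
    have hle : N + j ≤ Nat.pair i (N + j) := Nat.right_le_pair _ _
    refine ⟨Nat.pair i (N + j), by lia, ?_⟩
    have hv : v (2 * Nat.pair i (N + j) + 1) = q i := by
      simp only [v]
      rw [show (2 * Nat.pair i (N + j) + 1) / 2 = Nat.pair i (N + j) by lia, Nat.unpair_pair]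
    have hle' : (j : ℝ) ≤ ((2 * Nat.pair i (N + j) + 1 : ℕ) : ℝ) := by
      exact_mod_cast (by lia)
    beta_reduce
    rw [hv, if_pos ⟨odd_two_mul_add_one _, hj.trans hle'⟩]
    simpa [Real.dist_eq] using hi

/-- A function which on `tailSet s` is the limit of the rows with phase `s`, and which vanishes
outside all the tail sets, is extendable, whatever its values on the other tail sets. -/
theorem exists_limits_isExtendable : ∃ L : ℝ → ℝ → ℝ, ∀ s ∈ Set.Ioo (0 : ℝ) (1 / 2), ∀ f : ℝ → ℝ,
    (∀ x ∈ tailSet s, f x = L s x) →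
    (∀ x, (∀ t ∈ Set.Ioo (0 : ℝ) (1 / 2), x ∉ tailSet t) → f x = 0) → IsExtendable f := by
  obtain ⟨a, ha, ha0, had⟩ := exists_targets
  choose! L hL using fun s x => exists_tendsto_row a (s := s) (x := x)
  refine ⟨L, fun s hs f hfs hf0 => (isRowSystem_row ha s).isExtendable fun x ε hε => ?_⟩
  by_cases hx : x ∈ tailSet s
  · rw [hfs x hx]
    exact ((Metric.tendsto_nhds.1 (hL s x hx) ε hε).mono fun n hn => by
      rwa [← Real.dist_eq]).frequently
  by_cases hx' : ∀ t ∈ Set.Ioo (0 : ℝ) (1 / 2), x ∉ tailSet t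
  · refine (frequently_row_eq_zero ha0 hx).mono fun n hn => ?_
    rw [hn, hf0 x hx', sub_zero, abs_zero]
    exact hε
  push Not at hx'
  obtain ⟨t, ht, hxt⟩ := hx'
  have hst : s ≠ t := by
    rintro rfl
    exact hx hxt
  obtain ⟨N, hN⟩ := Filter.eventually_atTop.1 (eventually_two_le_phaseDist hs ht hst hxt)
  rw [Filter.frequently_atTop]
  intro m
  obtain ⟨n, hn, hn'⟩ := Filter.frequently_atTop.1 (had (f x) ε hε) (N + m)
  refine ⟨2 * n + 2, by lia, ?_⟩
  rwa [row_succ_of_two_le a (hN _ (by lia)) (hN _ (by lia))]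

/-! ### The closed subspace -/

theorem IsConnectivity.const_mul {X : Type*} [TopologicalSpace X] {F : X → ℝ}
    (hF : IsConnectivity F) (c : ℝ) : IsConnectivity fun x => c * F x := by
  intro Z hZ
  have h := (hF Z hZ).image (fun p : X × ℝ => (p.1, c * p.2)) (by fun_prop)
  convert h using 1
  ext ⟨x, y⟩
  constructor
  · rintro ⟨h1, h2⟩
    exact ⟨(x, F x), ⟨h1, rfl⟩, Prod.ext rfl h2.symm⟩
  · rintro ⟨⟨x', y'⟩, ⟨h1, h2⟩, h3⟩
    obtain ⟨rfl, rfl⟩ := Prod.mk.inj h3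
    exact ⟨h1, congrArg (c * ·) h2⟩

theorem IsExtendable.const_mul {X : Type*} [TopologicalSpace X] {f : X → ℝ}
    (hf : IsExtendable f) (c : ℝ) : IsExtendable fun x => c * f x := by
  obtain ⟨F, hF, hfF⟩ := hf
  exact ⟨fun p => c * F p, hF.const_mul c, fun x => congrArg (c * ·) (hfF x)⟩

/-- There are fewer Borel sets than sets of reals, so some set of reals is not the preimage of a
Borel set under the given map. -/
theorem exists_ne_preimage_measurableSet (p : ℝ → ℝ) :
    ∃ N : Set ℝ, ∀ S : Set ℝ, MeasurableSet S → p ⁻¹' S ≠ N := by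
  by_contra! h
  have hsurj : Function.Surjective fun S : {S : Set ℝ | MeasurableSet S} => p ⁻¹' S.1 := by
    intro N
    obtain ⟨S, hS, hN⟩ := h N
    exact ⟨⟨S, hS⟩, hN⟩
  have h1 := mk_le_of_surjective hsurj
  have h2 : #{S : Set ℝ | MeasurableSet S} ≤ 𝔠 := by
    have := MeasurableSpace.cardinal_measurableSet_le_continuum
      (s := MeasurableSpace.countableGeneratingSet ℝ)
      ((MeasurableSpace.countable_countableGeneratingSet (α := ℝ)).le_aleph0.trans
        aleph0_le_continuum)
    rwa [MeasurableSpace.generateFrom_countableGeneratingSet] at this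
  rw [mk_set, mk_real] at h1
  exact absurd (h1.trans h2) (not_le.2 (cantor _))

/-- A labelling `σ` of the reals by reals and a function `φ` such that every product
`g (σ x) * φ x`, with `g ≠ 0`, is extendable and not Borel, and such that `φ` takes every value
continuum many times in every open set, on the points with any given label. -/
theorem exists_label_and_weight : ∃ σ φ : ℝ → ℝ,
    (∀ g : ℝ → ℝ, ∀ s, g s ≠ 0 → IsExtendable fun x => g (σ x) * φ x) ∧
    (∀ s y, ∀ G : Set ℝ, IsOpen G → G.Nonempty → 𝔠 ≤ #{x | x ∈ G ∧ σ x = s ∧ φ x = y}) ∧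
    ∀ g : ℝ → ℝ, ∀ s, g s ≠ 0 → ¬ Measurable fun x => g (σ x) * φ x := by
  classical
  obtain ⟨L, hL⟩ := exists_limits_isExtendable
  -- The tail sets used for `s` are one that makes the function extendable, a family indexed by
  -- `(y, u)` that provides many points with the value `y`, and a family that destroys
  -- measurability.
  obtain ⟨e⟩ : Nonempty (ℝ ⊕ (ℝ × ℝ × ℝ) ⊕ (ℝ × ℝ) ↪ Set.Ioo (0 : ℝ) (1 / 2)) := by
    rw [← Cardinal.le_def, mk_Ioo_real (by norm_num)]
    simp [mk_real]
  set A : ℝ ⊕ (ℝ × ℝ × ℝ) ⊕ (ℝ × ℝ) → Set ℝ := fun i => tailSet (e i) with hA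
  have hdisj : ∀ i j x, x ∈ A i → x ∈ A j → i = j := fun i j x hi hj => by
    by_contra hij
    exact Set.disjoint_left.1 (disjoint_tailSet (e i).2 (e j).2
      fun h => hij (e.injective (Subtype.ext h))) hi hj
  choose p hp using fun i => (dense_tailSet (e i)).nonempty
  choose N hN using fun s => exists_ne_preimage_measurableSet fun w => p (.inr (.inr (s, w)))
  let val : ℝ ⊕ (ℝ × ℝ × ℝ) ⊕ (ℝ × ℝ) → ℝ → ℝ × ℝ
    | .inl s, x => (s, L (e (.inl s)) x)
    | .inr (.inl t), _ => (t.1, t.2.1)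
    | .inr (.inr t), _ => (t.1, if t.2 ∈ N t.1 then 1 else 0)
  let lab : ℝ → ℝ × ℝ := fun x => if h : ∃ i, x ∈ A i then val h.choose x else 0
  have hlab : ∀ i x, x ∈ A i → lab x = val i x := fun i x hx => by
    have h : ∃ i, x ∈ A i := ⟨i, hx⟩
    simp only [lab, dif_pos h]
    rw [hdisj _ _ x h.choose_spec hx]
  refine ⟨fun x => (lab x).1, fun x => (lab x).2, fun g s hg => ?_, fun s y G hG hG0 => ?_,
    fun g s hg hm => ?_⟩
  · have h := (hL (e (.inl s)) (e _).2 (fun x => (g s)⁻¹ * (g (lab x).1 * (lab x).2))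
      (fun x hx => by
        have := hlab (.inl s) x hx
        rw [this]
        simp only [val]
        field_simp)
      (fun x hx => by
        have : ¬ ∃ i, x ∈ A i := fun ⟨i, hi⟩ => hx _ (e i).2 hi
        simp only [lab, dif_neg this, Prod.snd_zero, mul_zero])).const_mul (g s)
    simpa [mul_inv_cancel_left₀ hg] using h
  · choose q hqG hqA using fun u => (dense_tailSet (e (.inr (.inl (s, y, u))))).inter_open_nonempty
      G hG hG0
    rw [← mk_real]
    refine mk_le_of_injective (f := fun u => ⟨q u, hqG u, ?_, ?_⟩) fun u v huv => ?_
    · exact congrArg Prod.fst (hlab _ _ (hqA u))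
    · exact congrArg Prod.snd (hlab _ _ (hqA u))
    · have huv : q u = q v := congrArg Subtype.val huv
      have := hdisj _ _ (q u) (hqA u) (huv ▸ hqA v)
      simpa using this
  · refine hN s {x | g (lab x).1 * (lab x).2 ≠ 0} (hm (measurableSet_singleton 0).compl) ?_
    ext w
    simp only [Set.mem_preimage, Set.mem_ofPred_eq]
    rw [hlab _ _ (hp (.inr (.inr (s, w))))]
    simp [val, hg]

theorem rank_real_fun : Module.rank ℝ (ℝ → ℝ) = 2 ^ 𝔠 := by
  rw [rank_fun_infinite, ← power_def, mk_real, power_self_eq aleph0_le_continuum]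

theorem isSpaceable_two_power_continuum :
    IsSpaceable ℝ ((ExtFun ∩ SESFun) \ BorelFun) ((2 : Cardinal.{0}) ^ 𝔠) := by
  obtain ⟨σ, φ, hext, hses, hnb⟩ := exists_label_and_weight
  let Φ : (ℝ → ℝ) →ₗ[ℝ] (ℝ → ℝ) :=
    { toFun := fun g x => g (σ x) * φ x
      map_add' := fun g h => by ext x; simp [add_mul]
      map_smul' := fun c g => by ext x; simp [mul_assoc] }
  have hΦ : ∀ g x, Φ g x = g (σ x) * φ x := fun g x => rfl
  -- Reading off `g s` at a point with the label `s` and the weight `1` shows that the subspace is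
  -- closed.
  have hq : ∀ s, ∃ x, σ x = s ∧ φ x = 1 := fun s => by
    have h := (aleph0_pos.trans_le aleph0_le_continuum).trans_le
      (hses s 1 Set.univ isOpen_univ Set.univ_nonempty)
    obtain ⟨⟨x, -, hx⟩⟩ := mk_ne_zero_iff.1 h.ne'
    exact ⟨x, hx⟩
  choose q hqσ hqφ using hq
  have hval : ∀ g s, Φ g (q s) = g s := fun g s => by rw [hΦ, hqσ, hqφ, mul_one]
  have hinj : Function.Injective Φ := fun g h hgh => by
    ext s
    rw [← hval g, ← hval h, hgh]
  refine ⟨LinearMap.range Φ, ?_, ?_, ?_⟩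
  · have : (LinearMap.range Φ : Set (ℝ → ℝ)) = ⋂ x, {f | f x = f (q (σ x)) * φ x} := by
      ext f
      simp only [SetLike.mem_coe, LinearMap.mem_range, Set.mem_iInter, Set.mem_ofPred_eq]
      constructor
      · rintro ⟨g, rfl⟩ x
        rw [hval, hΦ]
      · intro h
        exact ⟨fun s => f (q s), funext fun x => by rw [hΦ, h x]⟩
    rw [this]
    exact isClosed_iInter fun x => isClosed_eq (continuous_apply x)
      ((continuous_apply _).mul continuous_const)
  · rintro _ ⟨g, rfl⟩
    by_cases hg : g = 0
    · right
      rw [hg, map_zero]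
      rfl
    left
    obtain ⟨s, hs⟩ := Function.ne_iff.1 hg
    refine ⟨⟨hext g s hs, fun y G hG hG0 => le_antisymm (mk_real ▸ mk_set_le _) ?_⟩, hnb g s hs⟩
    refine (hses s ((g s)⁻¹ * y) G hG hG0).trans (mk_le_mk_of_subset ?_)
    rintro x ⟨h1, h2, h3⟩
    refine ⟨?_, h1⟩
    rw [Set.mem_preimage, hΦ, h2, h3, mul_inv_cancel_left₀ hs]
    rfl
  · rw [← (LinearEquiv.ofInjective Φ hinj).rank_eq, rank_real_fun]

/- The topology on `ℝ → ℝ` is Mathlib's product topology, that is, pointwise convergence. -/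
theorem mainTheorem4 :
    spaceabilityNumber ℝ ((ExtFun ∩ SESFun) \ BorelFun) = Order.succ ((2 : Cardinal.{0}) ^ 𝔠) ∧
      IsSpaceable ℝ ((ExtFun ∩ SESFun) \ BorelFun) ((2 : Cardinal.{0}) ^ 𝔠) := by
  have hsp := isSpaceable_two_power_continuum
  have hmem : Order.succ ((2 : Cardinal.{0}) ^ 𝔠) ∈
      {κ | ¬ ∃ μ, κ ≤ μ ∧ IsSpaceable ℝ ((ExtFun ∩ SESFun) \ BorelFun) μ} := by
    rintro ⟨_, hμ, V, -, -, rfl⟩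
    have h := (Order.succ_le_iff.1 hμ).trans_le (Submodule.rank_le V)
    rw [rank_real_fun] at h
    exact lt_irrefl _ h
  refine ⟨le_antisymm (csInf_le' hmem) (le_csInf ⟨_, hmem⟩ fun κ hκ => ?_), hsp⟩
  rw [Order.succ_le_iff]
  by_contra! h
  exact hκ ⟨_, h, hsp⟩
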